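/- **Setting.** There are $K\ge 1$ agents (arms) $\mathcal A$, $m\ge1$ experts $h\in\mathcal H$, each a map $h:\mathcal X\to\mathcal A$ from contexts to agents, and $T\ge1$ rounds. Agent $a$ has value $\mu(a)\in[0,1]$ per click, and click-through rates are $\rho:\mathcal A\times\mathcal X\to[0,1]$. In round $t$ a context $x^t$ is drawn i.i.d. from a fixed distribution, every agent (not observing $x^t$) submits a bid $b^t(a)\in[0,1]$, which may depend on everything that happened in earlier rounds and on private randomness, the mechanism displays an agent $a^t$, and she is clicked ($c^t=1$) with probability $\rho(a^t,x^t)$, otherwise $c^t=0$. Let $\Pi(a,h)=\mathbb E_x[\rho(a,x)\mathbf 1\{h(x)=a\}]$ and $R(h,\mu)=\mathbb E_x[\mu(h(x))\rho(h(x),x)]$. The expected welfare regret is $$\mathrm{Reg}(T)=\mathbb E\Big[T\max_{h\in\mathcal H}R(h,\mu)-\sum_{t=1}^T c^t\mu(a^t)\Big].$$ **Contextual $\varepsilon$-greedy mechanism.** In each round, with probability $\varepsilon$ (independently of everything else) the mechanism *explores*: it displays a uniformly random agent and charges nothing. Otherwise it *exploits*: with $t_e$ the set of past explore rounds, it computes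 $$\hat\Pi^t(a,h)=\frac{K}{|t_e|}\sum_{\tau\in t_e}\mathbf 1\{h(x^\tau)=a\}\,\mathbf 1\{a^\tau=a\}\,c^\tau$$ ($0$ if $t_e=\emptyset$), lets $h^t(b)\in\arg\max_h\sum_i\hat\Pi^t(i,h)b(i)$ for every bid profile $b$ (ties broken by an arbitrary fixed rule), and displays $a^t=h^t(b^t)(x^t)$. Write $\hat g^t(a,y)=\hat\Pi^t(a,h^t(y,b^t_{-a}))$. If the displayed agent $a$ is clicked, she pays $p^t(a,b)$ at her bid $b=b^t(a)$, where $p^t(a,b)=b-\frac{1}{\hat g^t(a,b)}\int_0^b\hat g^t(a,z)\,dz$ if $\hat g^t(a,b)>0$, and $p^t(a,b)=0$ otherwise. **$\alpha$-rationality.** The expected exploit-round utility of agent $a$ from bidding $y$, given the past and the other agents' bids, is $u^t(a,y)=(\mu(a)-p^t(a,y))\,\Pi(a,h^t(y,b^t_{-a}))$. Agent $a$ is $\alpha$-rational if, almost surely, in every round $t$ in which $u^t(a,y)-u^t(a,\mu(a))\le\alpha$ for all $y\in[0,1]$, she bids $b^t(a)=\mu(a)$. **Theorem.** Let $0<\alpha\le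 1$ and suppose that all agents are $\alpha$-rational. If $0<\varepsilon\le1$, then $$\mathrm{Reg}(T)\le T\varepsilon+K^2\sqrt{\frac{8T\log(TmK)}{\varepsilon}}+3K+\frac{8K^2\log(TmK)}{\varepsilon\alpha^2}.$$ Moreover, with $\varepsilon=\min\{1,\,2T^{-1/3}\log(TmK)^{1/3}K^{4/3}\}$, $$\mathrm{Reg}(T)\le\widetilde O\!\left(T^{2/3}K^{4/3}+\frac{T^{1/3}K^{2/3}}{\alpha^2}\right),$$ that is, there are absolute constants $C,k$ such that, for all instances, $\mathrm{Reg}(T)\le C\,(1+\log(TmK))^k\,\big(T^{2/3}K^{4/3}+T^{1/3}K^{2/3}/\alpha^2\big)$. -/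

import Mathlib

open MeasureTheory

universe u v

namespace PPC

/-- A contextual pay-per-click auction instance with `K` agents (arms) and `m` experts on the
context space `X`. -/
structure Instance (X : Type u) [MeasurableSpace X] (K m : ℕ) where
  /-- the law of the context `x^t`, drawn i.i.d. in every round -/
  ctxLaw : ProbabilityMeasure X
  /-- the click-through rates `ρ(a, x)` -/
  ctr : Fin K → X → ℝ
  ctr_measurable : ∀ a, Measurable (ctr a)
  ctr_mem : ∀ a x, ctr a x ∈ Set.Icc (0 : ℝ) 1
  /-- the values per click `μ(a)` -/
  value : Fin K → ℝ
  value_mem : ∀ a, value a ∈ Set.Icc (0 : ℝ) 1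
  /-- the experts `h : X → A`, indexed by `Fin m` -/
  expert : Fin m → X → Fin K
  expert_measurable : ∀ h, Measurable (expert h)

/-- An implementation of `argmax_h s(h)` over the `m` experts: an arbitrary (measurable)
tie-breaking rule. -/
structure ArgmaxRule (m : ℕ) where
  pick : (Fin m → ℝ) → Fin m
  isMax : ∀ (s : Fin m → ℝ) (h : Fin m), s h ≤ s (pick s)
  measurable : Measurable pick

/-- What is recorded about one round: the context, whether the round was an explore round, the
displayed arm, and whether it was clicked. -/
abbrev Round (X : Type u) (K : ℕ) : Type u := X × Bool × Fin K × Bool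

namespace Round

variable {X : Type u} {K : ℕ}

def context (r : Round X K) : X := r.1
def explored (r : Round X K) : Bool := r.2.1
def arm (r : Round X K) : Fin K := r.2.2.1
def clicked (r : Round X K) : Bool := r.2.2.2

end Round

/-- The record of the first `t` rounds. -/
abbrev History (X : Type u) (K t : ℕ) : Type u := Fin t → Round X K

noncomputable section

variable {X : Type u} [MeasurableSpace X] {K m : ℕ}

/-- Expected welfare of an expert at the true values: `R(h, μ) = E_x[μ(h(x)) ρ(h(x), x)]`. -/
def expertWelfare (I : Instance X K m) (h : Fin m) : ℝ :=
  ∫ x, I.value (I.expert h x) * I.ctr (I.expert h x) x ∂(I.ctxLaw : Measure X)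

/-- `R(h*, μ)`, the expected welfare of the best expert. -/
def bestWelfare (I : Instance X K m) : ℝ := ⨆ h, expertWelfare I h

/-- Click probability of agent `a` induced by expert `h`: `Π(a, h) = E_x[ρ(a, x) 1{h(x) = a}]`. -/
def clickProb (I : Instance X K m) (a : Fin K) (h : Fin m) : ℝ :=
  ∫ x, I.ctr a x * (if I.expert h x = a then 1 else 0) ∂(I.ctxLaw : Measure X)

/-- The set `t_e` of past explore rounds. -/
def exploreRounds {t : ℕ} (H : History X K t) : Finset (Fin t) :=
  Finset.univ.filter fun τ => (H τ).explored = true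

/-- The empirical estimate
`Π̂(a, h) = (K / |t_e|) ∑_{τ ∈ t_e} 1{h(x^τ) = a} 1{a^τ = a} c^τ`
(it is `0` while there has been no explore round). -/
def estimate (I : Instance X K m) {t : ℕ} (H : History X K t) (a : Fin K) (h : Fin m) : ℝ :=
  (∑ τ ∈ exploreRounds H,
      if I.expert h (H τ).context = a ∧ (H τ).arm = a ∧ (H τ).clicked = true then (1 : ℝ) else 0)
    * K / (exploreRounds H).card

/-- The expert followed in an exploit round with history `H` and bids `b`:
`argmax_h ∑_i Π̂(i, h) b_i`. -/
def followed (I : Instance X K m) (S : ArgmaxRule m) {t : ℕ} (H : History X K t)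
    (b : Fin K → ℝ) : Fin m :=
  S.pick fun h => ∑ i, estimate I H i h * b i

/-- The estimated click probability `ĝ(a, y)` of agent `a` when her bid in the bid profile `b` is
replaced by `y`. -/
def estClickProb (I : Instance X K m) (S : ArgmaxRule m) {t : ℕ} (H : History X K t)
    (b : Fin K → ℝ) (a : Fin K) (y : ℝ) : ℝ :=
  estimate I H a (followed I S H (Function.update b a y))

/-- The price charged to agent `a` in an exploit round in which she is displayed and clicked, at
the bid profile `b`. -/
def price (I : Instance X K m) (S : ArgmaxRule m) {t : ℕ} (H : History X K t)
    (b : Fin K → ℝ) (a : Fin K) : ℝ :=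
  if 0 < estClickProb I S H b a (b a) then
    b a - (∫ z in (0 : ℝ)..(b a), estClickProb I S H b a z) / estClickProb I S H b a (b a)
  else 0

/-- The expected exploit-round utility `u(a, y) = (μ(a) - p(a, y)) g(a, y)` of agent `a` when she
bids `y` and the others bid according to `b`. Here `g(a, y)` is her true click probability over a
fresh context, which is `Π(a, h)` for the expert `h` that the mechanism then follows. -/
def utility (I : Instance X K m) (S : ArgmaxRule m) {t : ℕ} (H : History X K t)
    (b : Fin K → ℝ) (a : Fin K) (y : ℝ) : ℝ :=
  (I.value a - price I S H (Function.update b a y) a)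
    * clickProb I a (followed I S H (Function.update b a y))

/-- A profile of bidding strategies. In each round the bids in `[0, 1]` are a function of the
record of all past rounds and of a private random seed `w : W` (past bids and payments are
themselves functions of these). The current context is not observed. -/
structure BidStrategy (W : Type v) [MeasurableSpace W] (X : Type u) [MeasurableSpace X]
    (K : ℕ) where
  bid : (t : ℕ) → W → History X K t → Fin K → ℝ
  measurable : ∀ t, Measurable fun p : W × History X K t => bid t p.1 p.2
  mem : ∀ t w H a, bid t w H a ∈ Set.Icc (0 : ℝ) 1

/-- The randomness of one round: a context, a uniform variable deciding between explore and
exploit, an arm to be shown in case of exploring, and a uniform variable deciding the click. -/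
abbrev Noise (X : Type u) (K : ℕ) : Type u := X × unitInterval × Fin K × unitInterval

/-- One round of the contextual `ε`-greedy mechanism with history `H` and bids `b`. With
probability `ε` it explores, showing a uniformly random arm; otherwise it shows the arm
recommended by the followed expert. The arm `a` shown is clicked with probability `ρ(a, x)`. -/
def playRound (I : Instance X K m) (S : ArgmaxRule m) (ε : ℝ) {t : ℕ} (H : History X K t)
    (b : Fin K → ℝ) (z : Noise X K) : Round X K :=
  let explore : Bool := decide ((z.2.1 : ℝ) < ε)
  let a : Fin K := if explore = true then z.2.2.1 else I.expert (followed I S H b) z.1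
  (z.1, explore, a, decide ((z.2.2.2 : ℝ) < I.ctr a z.1))

variable {W : Type v} [MeasurableSpace W]

/-- The record of the first `t` rounds when the mechanism is run against the strategies `σ`. -/
def history (I : Instance X K m) (S : ArgmaxRule m) (ε : ℝ) (σ : BidStrategy W X K)
    (w : W) (z : ℕ → Noise X K) : (t : ℕ) → History X K t
  | 0 => Fin.elim0
  | t + 1 =>
    Fin.snoc (α := fun _ => Round X K) (history I S ε σ w z t)
      (playRound I S ε (history I S ε σ w z t) (σ.bid t w (history I S ε σ w z t)) (z t))

/-- The bids submitted in round `t` (rounds are numbered from `0`). -/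
def bids (I : Instance X K m) (S : ArgmaxRule m) (ε : ℝ) (σ : BidStrategy W X K)
    (w : W) (z : ℕ → Noise X K) (t : ℕ) : Fin K → ℝ :=
  σ.bid t w (history I S ε σ w z t)

/-- The outcome of round `t`. -/
def outcome (I : Instance X K m) (S : ArgmaxRule m) (ε : ℝ) (σ : BidStrategy W X K)
    (w : W) (z : ℕ → Noise X K) (t : ℕ) : Round X K :=
  playRound I S ε (history I S ε σ w z t) (bids I S ε σ w z t) (z t)

/-- The law of the randomness of one round: all four components are independent. -/
def noiseLaw [NeZero K] (I : Instance X K m) : Measure (Noise X K) :=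
  (I.ctxLaw : Measure X).prod
    ((volume : Measure unitInterval).prod
      ((PMF.uniformOfFintype (Fin K)).toMeasure.prod (volume : Measure unitInterval)))

instance [NeZero K] (I : Instance X K m) : IsProbabilityMeasure (noiseLaw I) := by
  unfold noiseLaw
  infer_instance

/-- The law of a run: the agents' seed, and independent noise for every round. -/
def runLaw [NeZero K] (I : Instance X K m) (ν : ProbabilityMeasure W) :
    Measure (W × (ℕ → Noise X K)) :=
  (ν : Measure W).prod (Measure.infinitePi fun _ : ℕ => noiseLaw I)

/-- All agents are `α`-rational during the first `T` rounds: almost surely, in every round, every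
agent who can gain at most `α` in that round by misreporting bids her true value. -/
def AlphaRational [NeZero K] (I : Instance X K m) (S : ArgmaxRule m) (ε : ℝ)
    (ν : ProbabilityMeasure W) (σ : BidStrategy W X K) (T : ℕ) (α : ℝ) : Prop :=
  ∀ᵐ ω ∂(runLaw I ν), ∀ t < T, ∀ a : Fin K,
    (∀ y ∈ Set.Icc (0 : ℝ) 1,
      utility I S (history I S ε σ ω.1 ω.2 t) (bids I S ε σ ω.1 ω.2 t) a y
        - utility I S (history I S ε σ ω.1 ω.2 t) (bids I S ε σ ω.1 ω.2 t) a (I.value a) ≤ α) →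
    bids I S ε σ ω.1 ω.2 t a = I.value a

/-- The welfare regret `T R(h*, μ) - ∑_t c^t μ(a^t)` of a run of `T` rounds. -/
def regret (I : Instance X K m) (S : ArgmaxRule m) (ε : ℝ) (σ : BidStrategy W X K) (T : ℕ)
    (ω : W × (ℕ → Noise X K)) : ℝ :=
  T * bestWelfare I
    - ∑ t ∈ Finset.range T,
        (if (outcome I S ε σ ω.1 ω.2 t).clicked = true then (1 : ℝ) else 0)
          * I.value (outcome I S ε σ ω.1 ω.2 t).arm

end

end PPC

/-!
The regret splits into the explore rounds, which cost at most `T ε` in expectation, and the welfare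
gaps of the experts followed in exploit rounds.

*Incentives.* The allocation computed from the estimates is monotone in each bid
(`estClickProb_monotone`), and the price is Myerson's price for it, so truthful bidding is optimal
for the estimated click probabilities (`estimated_utility_le`). If these are within `D` of the true
ones, misreporting gains at most `2 D` (`utility_sub_le`), whatever the other agents bid. Hence
`α`-rational agents are truthful as soon as `2 D ≤ α`.

*Concentration.* The samples collected in explore rounds depend neither on bids nor on the past, so
they are functions of i.i.d. noise. Their number is random; this is handled by the exponential
moment of the sum of `1{explore} (s (Y - E Y) - s² / 8)`, which is at most one by Hoeffding's lemma
(`integral_exp_explored_deviation_le_one`). With `L = log (T m K)` and `δ = √(2 L / (t ε))`, after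
`t` rounds all estimates are within `K δ` except with probability of order `m K (T m K)⁻²`
(`real_not_isAccurate_le`). The welfare of an expert is estimated as a single bounded sample, and so
also up to `K δ`, rather than `K² δ` from adding the errors of the arms.

*Summation.* `2 K δ ≤ α` holds from round `8 K² L / (ε α²)` on, and then the gap is at most `2 K δ`
(`bestWelfare_sub_followedAt_le`). Summing `1 / √t` gives `2 K √(8 T L / ε)`, which is within the
claimed term if `K ≥ 2`. For `K = 1` the expected regret vanishes
(`integral_regret_eq_zero_of_subsingleton`). The bound for the tuned `ε` is a computation in the
cube roots of `T`, `K` and `L` (`tuned_bound`).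
-/

namespace PPC

/-! ### Approximate truthfulness of the exploit rounds -/

section Truthful

variable {X : Type u} [MeasurableSpace X] {K m : ℕ}

lemma estimate_nonneg (I : Instance X K m) {t : ℕ} (H : History X K t) (a : Fin K) (h : Fin m) :
    0 ≤ estimate I H a h := by
  unfold estimate
  have : 0 ≤ ∑ τ ∈ exploreRounds H,
      if I.expert h (H τ).context = a ∧ (H τ).arm = a ∧ (H τ).clicked = true
        then (1 : ℝ) else 0 :=
    Finset.sum_nonneg fun _ _ => by split_ifs <;> norm_num
  positivity

/-- Allocation monotonicity: the followed expert maximizes a score that is affine in the bid `y`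
with slope `estimate I H a h`, so raising `y` can only select an expert of larger slope. -/
lemma estClickProb_monotone (I : Instance X K m) (S : ArgmaxRule m) {t : ℕ} (H : History X K t)
    (b : Fin K → ℝ) (a : Fin K) : Monotone (estClickProb I S H b a) := by
  intro y z hyz
  rcases hyz.eq_or_lt with rfl | hlt
  · exact le_rfl
  have score (w : ℝ) (h : Fin m) : ∑ i, estimate I H i h * Function.update b a w i
      = estimate I H a h * w + ∑ i ∈ Finset.univ \ {a}, estimate I H i h * b i := by
    rw [Finset.sum_eq_add_sum_sdiff_singleton_of_mem (Finset.mem_univ a)]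
    congr 1
    · simp
    · refine Finset.sum_congr rfl fun i hi => ?_
      rw [Function.update_of_ne]
      simpa using hi
  unfold estClickProb
  have h1 := S.isMax (fun h => ∑ i, estimate I H i h * Function.update b a y i)
    (followed I S H (Function.update b a z))
  have h2 := S.isMax (fun h => ∑ i, estimate I H i h * Function.update b a z i)
    (followed I S H (Function.update b a y))
  simp only [score] at h1 h2
  have e1 : S.pick (fun h => estimate I H a h * y
      + ∑ i ∈ Finset.univ \ {a}, estimate I H i h * b i)
      = followed I S H (Function.update b a y) := by
    unfold followed; simp only [score]
  have e2 : S.pick (fun h => estimate I H a h * z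
      + ∑ i ∈ Finset.univ \ {a}, estimate I H i h * b i)
      = followed I S H (Function.update b a z) := by
    unfold followed; simp only [score]
  rw [e1] at h1
  rw [e2] at h2
  nlinarith

/-- The price depends on the bid `y` through Myerson's formula for the monotone allocation
`estClickProb I S H b a`. -/
lemma price_update_mul (I : Instance X K m) (S : ArgmaxRule m) {t : ℕ} (H : History X K t)
    (b : Fin K → ℝ) (a : Fin K) {y : ℝ} (hy : 0 ≤ y) :
    price I S H (Function.update b a y) a * estClickProb I S H b a y
      = y * estClickProb I S H b a y - ∫ z in (0 : ℝ)..y, estClickProb I S H b a z := by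
  have hG : ∀ z, estClickProb I S H (Function.update b a y) a z = estClickProb I S H b a z := by
    intro z; simp [estClickProb]
  unfold price
  simp only [hG, Function.update_self]
  have hnn : ∀ z, 0 ≤ estClickProb I S H b a z := fun z => estimate_nonneg _ _ _ _
  split_ifs with hpos
  · field_simp
  -- Where the allocation at `y` vanishes it vanishes below `y` too, so the convention that the
  -- price is `0` agrees with the formula.
  · have h0 : estClickProb I S H b a y = 0 := le_antisymm (not_lt.1 hpos) (hnn y)
    have : ∫ z in (0 : ℝ)..y, estClickProb I S H b a z = 0 := by
      rw [intervalIntegral.integral_congr (g := fun _ => (0 : ℝ))]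
      · simp
      · intro z hz
        rw [Set.uIcc_of_le hy] at hz
        exact le_antisymm (h0 ▸ estClickProb_monotone I S H b a hz.2) (hnn z)
    rw [h0, this]; ring

lemma price_update_mem (I : Instance X K m) (S : ArgmaxRule m) {t : ℕ} (H : History X K t)
    (b : Fin K → ℝ) (a : Fin K) {y : ℝ} (hy : y ∈ Set.Icc (0 : ℝ) 1) :
    price I S H (Function.update b a y) a ∈ Set.Icc (0 : ℝ) 1 := by
  have hnn : ∀ z, 0 ≤ estClickProb I S H b a z := fun z => estimate_nonneg _ _ _ _
  have hmono := estClickProb_monotone I S H b a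
  have hG : estClickProb I S H (Function.update b a y) a (Function.update b a y a)
      = estClickProb I S H b a y := by simp [estClickProb]
  by_cases hpos : 0 < estClickProb I S H b a y
  · have key := price_update_mul I S H b a hy.1
    have hint0 : 0 ≤ ∫ z in (0 : ℝ)..y, estClickProb I S H b a z :=
      intervalIntegral.integral_nonneg hy.1 fun z _ => hnn z
    have hint1 : ∫ z in (0 : ℝ)..y, estClickProb I S H b a z ≤ y * estClickProb I S H b a y := by
      have := intervalIntegral.integral_mono_on (μ := volume)
        (g := fun _ => estClickProb I S H b a y) hy.1 hmono.intervalIntegrable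
        intervalIntegrable_const (fun z hz => hmono hz.2)
      simpa using this
    constructor
    · by_contra! hneg
      nlinarith
    · by_contra! hgt
      nlinarith [hy.2]
  · unfold price
    rw [hG, if_neg hpos]
    norm_num

/-- Bidding the value maximizes the utility computed with the estimated click probabilities. -/
lemma estimated_utility_le (I : Instance X K m) (S : ArgmaxRule m) {t : ℕ} (H : History X K t)
    (b : Fin K → ℝ) (a : Fin K) {y v : ℝ} (hy : 0 ≤ y) (hv : 0 ≤ v) :
    (v - price I S H (Function.update b a y) a) * estClickProb I S H b a y
      ≤ (v - price I S H (Function.update b a v) a) * estClickProb I S H b a v := by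
  have hmono := estClickProb_monotone I S H b a
  rw [sub_mul, sub_mul, price_update_mul I S H b a hy, price_update_mul I S H b a hv]
  have hii : ∀ p q, IntervalIntegrable (estClickProb I S H b a) volume p q := fun p q =>
    hmono.intervalIntegrable
  have hsplit := intervalIntegral.integral_add_adjacent_intervals (hii 0 y) (hii y v)
  have hge : (v - y) * estClickProb I S H b a y
      ≤ ∫ z in y..v, estClickProb I S H b a z := by
    rcases le_total y v with h | h
    · have := intervalIntegral.integral_mono_on (μ := volume)
        (f := fun _ => estClickProb I S H b a y) h
        intervalIntegrable_const (hii y v) (fun z hz => hmono hz.1)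
      simpa using this
    · have := intervalIntegral.integral_mono_on (μ := volume)
        (g := fun _ => estClickProb I S H b a y) h
        (hii v y) intervalIntegrable_const (fun z hz => hmono hz.2)
      rw [intervalIntegral.integral_symm]
      simp at this
      linarith
  linarith

/-- If all estimates are within `D` of the true click probabilities, then misreporting gains at
most `2 * D`: prices and values lie in `[0, 1]`, so replacing the estimates by the true click
probabilities changes each utility by at most `D`. -/
lemma utility_sub_le (I : Instance X K m) (S : ArgmaxRule m) {t : ℕ} (H : History X K t)
    (b : Fin K → ℝ) (a : Fin K) {D : ℝ} (hD : ∀ h, |estimate I H a h - clickProb I a h| ≤ D)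
    {y : ℝ} (hy : y ∈ Set.Icc (0 : ℝ) 1) :
    utility I S H b a y - utility I S H b a (I.value a) ≤ 2 * D := by
  have hv := I.value_mem a
  have step (w : ℝ) (hw : w ∈ Set.Icc (0 : ℝ) 1) :
      |(I.value a - price I S H (Function.update b a w) a) * estClickProb I S H b a w
        - utility I S H b a w| ≤ D := by
    unfold utility
    rw [← mul_sub, abs_mul]
    have hp := price_update_mem I S H b a hw
    have h1 : |I.value a - price I S H (Function.update b a w) a| ≤ 1 := by
      rw [abs_le]; constructor <;> linarith [hv.1, hv.2, hp.1, hp.2]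
    calc _ ≤ 1 * |estClickProb I S H b a w
            - clickProb I a (followed I S H (Function.update b a w))| := by gcongr
      _ ≤ D := by rw [one_mul]; exact hD _
  have h1 := abs_le.1 (step y hy)
  have h2 := abs_le.1 (step _ hv)
  have h3 := estimated_utility_le I S H b a hy.1 hv.1
  linarith [h1.1, h2.2]

end Truthful

/-! ### The randomness of one round -/

section Noise

/-- The indicator that a round with randomness `z` is an explore round. -/
noncomputable def exploreInd {X : Type u} {K : ℕ} (ε : ℝ) (z : Noise X K) : ℝ :=
  if (z.2.1 : ℝ) < ε then 1 else 0

lemma exploreInd_mem {X : Type u} {K : ℕ} (ε : ℝ) (z : Noise X K) :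
    exploreInd ε z ∈ Set.Icc (0 : ℝ) 1 := by
  unfold exploreInd
  split_ifs <;> norm_num

variable {X : Type u} [MeasurableSpace X] {K m : ℕ}

/-- The reward `c a` collected in an explore round if the displayed arm `a` agrees with expert `h`
and is clicked. The argument `s` is the context, the displayed arm and the click variable. -/
noncomputable def sample (I : Instance X K m) (h : Fin m) (c : Fin K → ℝ)
    (s : X × Fin K × unitInterval) : ℝ :=
  if I.expert h s.1 = s.2.1 ∧ (s.2.2 : ℝ) < I.ctr s.2.1 s.1 then c s.2.1 else 0

/-- The reward collected when the arm recommended by expert `h` is displayed. -/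
noncomputable def followReward (I : Instance X K m) (h : Fin m)
    (s : X × Fin K × unitInterval) : ℝ :=
  if (s.2.2 : ℝ) < I.ctr (I.expert h s.1) s.1 then I.value (I.expert h s.1) else 0

/-- The law of context, explored arm and click variable, without the explore/exploit coin. -/
noncomputable def coinFreeLaw [NeZero K] (I : Instance X K m) :
    Measure (X × Fin K × unitInterval) :=
  (I.ctxLaw : Measure X).prod
    ((PMF.uniformOfFintype (Fin K)).toMeasure.prod (volume : Measure unitInterval))

instance [NeZero K] (I : Instance X K m) : IsProbabilityMeasure (coinFreeLaw I) := by
  unfold coinFreeLaw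
  infer_instance

lemma measurable_ctr_uncurry (I : Instance X K m) :
    Measurable fun p : Fin K × X => I.ctr p.1 p.2 :=
  measurable_from_prod_countable_right fun a => I.ctr_measurable a

lemma measurable_sample (I : Instance X K m) (h : Fin m) (c : Fin K → ℝ) :
    Measurable (sample I h c) := by
  unfold sample
  refine Measurable.ite ?_ ((measurable_of_countable c).comp measurable_snd.fst) measurable_const
  refine MeasurableSet.inter ?_ ?_
  · exact measurableSet_eq_fun ((I.expert_measurable h).comp measurable_fst) measurable_snd.fst
  · exact measurableSet_lt (measurable_subtype_coe.comp measurable_snd.snd)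
      ((measurable_ctr_uncurry I).comp (measurable_snd.fst.prodMk measurable_fst))

lemma measurable_followReward (I : Instance X K m) (h : Fin m) :
    Measurable (followReward I h) := by
  have he : Measurable fun s : X × Fin K × unitInterval => I.expert h s.1 :=
    (I.expert_measurable h).comp measurable_fst
  unfold followReward
  refine Measurable.ite ?_ ((measurable_of_countable I.value).comp he) measurable_const
  exact measurableSet_lt (measurable_subtype_coe.comp measurable_snd.snd)
      ((measurable_ctr_uncurry I).comp (he.prodMk measurable_fst))

lemma measurable_exploreInd (ε : ℝ) : Measurable (exploreInd ε : Noise X K → ℝ) := by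
  unfold exploreInd
  exact Measurable.ite (measurableSet_lt (measurable_subtype_coe.comp measurable_snd.fst)
    measurable_const) measurable_const measurable_const

lemma sample_mem (I : Instance X K m) (h : Fin m) {c : Fin K → ℝ}
    (hc : ∀ a, c a ∈ Set.Icc (0 : ℝ) 1) (s) : sample I h c s ∈ Set.Icc (0 : ℝ) 1 := by
  unfold sample
  split_ifs
  · exact hc _
  · norm_num

lemma followReward_mem (I : Instance X K m) (h : Fin m) (s) :
    followReward I h s ∈ Set.Icc (0 : ℝ) 1 := by
  unfold followReward
  split_ifs
  · exact I.value_mem _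
  · norm_num

/-- The explore/exploit coin is independent of everything else in the round. -/
lemma integral_noise_mul [NeZero K] (I : Instance X K m) (φ : unitInterval → ℝ)
    (ψ : X × Fin K × unitInterval → ℝ) :
    ∫ z, φ z.2.1 * ψ (z.1, z.2.2) ∂(noiseLaw I) = (∫ u, φ u) * ∫ s, ψ s ∂(coinFreeLaw I) := by
  set Q := (PMF.uniformOfFintype (Fin K)).toMeasure.prod (volume : Measure unitInterval)
  have h1 : MeasurePreserving (MeasurableEquiv.prodAssoc.symm :
      X × unitInterval × (Fin K × unitInterval) ≃ᵐ _) (noiseLaw I)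
      (((I.ctxLaw : Measure X).prod (volume : Measure unitInterval)).prod Q) :=
    (measurePreserving_prodAssoc _ _ _).symm _
  have h2 : MeasurePreserving (Prod.map Prod.swap id)
      (((I.ctxLaw : Measure X).prod (volume : Measure unitInterval)).prod Q)
      (((volume : Measure unitInterval).prod (I.ctxLaw : Measure X)).prod Q) :=
    Measure.measurePreserving_swap.prod (MeasurePreserving.id _)
  have h3 := measurePreserving_prodAssoc (volume : Measure unitInterval) (I.ctxLaw : Measure X) Q
  have h := h3.comp (h2.comp h1)
  rw [← integral_prod_mul]
  exact h.integral_comp (MeasurableEquiv.measurableEmbedding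
    ((MeasurableEquiv.prodAssoc.symm.trans
      (MeasurableEquiv.prodCongr MeasurableEquiv.prodComm (MeasurableEquiv.refl _))).trans
      MeasurableEquiv.prodAssoc)) (fun p => φ p.1 * ψ p.2)

lemma volume_real_coe_lt {ε : ℝ} (hε : ε ∈ Set.Icc (0 : ℝ) 1) :
    (volume : Measure unitInterval).real {u | (u : ℝ) < ε} = ε := by
  have : {u : unitInterval | (u : ℝ) < ε} = Set.Iio ⟨ε, hε⟩ := by
    ext u; simp [← Subtype.coe_lt_coe]
  rw [this, measureReal_def, unitInterval.volume_Iio, ENNReal.toReal_ofReal hε.1]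

lemma integral_coin {ε : ℝ} (hε : ε ∈ Set.Icc (0 : ℝ) 1) (p q : ℝ) :
    ∫ u : unitInterval, (if (u : ℝ) < ε then p else q) = ε * p + (1 - ε) * q := by
  have hm : MeasurableSet {u : unitInterval | (u : ℝ) < ε} :=
    measurableSet_lt measurable_subtype_coe measurable_const
  have : (fun u : unitInterval => if (u : ℝ) < ε then p else q)
      = fun u => Set.indicator {u : unitInterval | (u : ℝ) < ε} (fun _ => p - q) u + q := by
    ext u
    by_cases h : (u : ℝ) < ε <;> simp [h]
  rw [this, integral_add ((integrable_const _).indicator hm) (integrable_const _),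
    integral_indicator_const _ hm, volume_real_coe_lt hε]
  simp
  ring

lemma sum_mul_clickProb (I : Instance X K m) (h : Fin m) (c : Fin K → ℝ) :
    ∑ a, c a * clickProb I a h
      = ∫ x, c (I.expert h x) * I.ctr (I.expert h x) x ∂(I.ctxLaw : Measure X) := by
  unfold clickProb
  simp_rw [← integral_const_mul]
  rw [← integral_finsetSum]
  · congr 1
    ext x
    simp
  · intro a _
    refine (Integrable.of_bound (C := 1) ?_ ?_).const_mul _
    · refine ((I.ctr_measurable a).mul (Measurable.ite ?_ measurable_const
        measurable_const)).aestronglyMeasurable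
      exact measurableSet_eq_fun (I.expert_measurable h) measurable_const
    · refine Filter.Eventually.of_forall fun x => ?_
      have := I.ctr_mem a x
      rw [Real.norm_eq_abs, abs_le]
      split_ifs <;> constructor <;> linarith [this.1, this.2]

lemma sum_value_mul_clickProb (I : Instance X K m) (h : Fin m) :
    ∑ a, I.value a * clickProb I a h = expertWelfare I h := sum_mul_clickProb I h I.value

lemma integral_sample [NeZero K] (I : Instance X K m) (h : Fin m) {c : Fin K → ℝ}
    (hc : ∀ a, c a ∈ Set.Icc (0 : ℝ) 1) :
    ∫ s, sample I h c s ∂(coinFreeLaw I) = (∑ a, c a * clickProb I a h) / K := by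
  have hb : ∀ s, ‖sample I h c s‖ ≤ 1 := fun s => by
    have := sample_mem I h hc s
    rw [Real.norm_eq_abs, abs_le]; constructor <;> linarith [this.1, this.2]
  rw [sum_mul_clickProb, ← integral_div]
  unfold coinFreeLaw
  rw [integral_prod _ (Integrable.of_bound (measurable_sample I h c).aestronglyMeasurable 1
    (Filter.Eventually.of_forall hb))]
  congr 1
  ext x
  have hint : Integrable (fun y => sample I h c (x, y))
      ((PMF.uniformOfFintype (Fin K)).toMeasure.prod (volume : Measure unitInterval)) :=
    Integrable.of_bound ((measurable_sample I h c).comp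
      measurable_prodMk_left).aestronglyMeasurable 1 (Filter.Eventually.of_forall fun _ => hb _)
  rw [integral_prod _ hint, PMF.integral_eq_sum]
  rw [Finset.sum_eq_single (I.expert h x)]
  · simp only [sample, true_and]
    rw [integral_coin (I.ctr_mem _ _)]
    simp
    ring
  · intro a _ ha
    simp [sample, ha.symm]
  · simp

lemma integral_followReward [NeZero K] (I : Instance X K m) (h : Fin m) :
    ∫ s, followReward I h s ∂(coinFreeLaw I) = expertWelfare I h := by
  have hb : ∀ s, ‖followReward I h s‖ ≤ 1 := fun s => by
    have := followReward_mem I h s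
    rw [Real.norm_eq_abs, abs_le]; constructor <;> linarith [this.1, this.2]
  unfold coinFreeLaw expertWelfare
  rw [integral_prod _ (Integrable.of_bound (measurable_followReward I h).aestronglyMeasurable 1
    (Filter.Eventually.of_forall hb))]
  congr 1
  ext x
  simp only [followReward]
  rw [integral_fun_snd (fun v : unitInterval => if (v : ℝ) < I.ctr (I.expert h x) x
    then I.value (I.expert h x) else 0), integral_coin (I.ctr_mem _ _)]
  simp
  ring

/-- The expected reward of a round in which expert `h` is followed unless the round explores. -/
lemma integral_exploit_reward [NeZero K] (I : Instance X K m) {ε : ℝ}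
    (hε : ε ∈ Set.Icc (0 : ℝ) 1) (h : Fin m) :
    ∫ z, (1 - exploreInd ε z) * followReward I h (z.1, z.2.2) ∂(noiseLaw I)
      = (1 - ε) * expertWelfare I h := by
  have := integral_noise_mul I (fun u => if (u : ℝ) < ε then 0 else 1) (followReward I h)
  rw [integral_coin hε, integral_followReward] at this
  convert this using 2
  · ext z
    unfold exploreInd
    split_ifs <;> simp
  · ring

lemma expertWelfare_mem (I : Instance X K m) (h : Fin m) :
    expertWelfare I h ∈ Set.Icc (0 : ℝ) 1 := by
  have h0 : ∀ x, 0 ≤ I.value (I.expert h x) * I.ctr (I.expert h x) x := fun x =>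
    mul_nonneg (I.value_mem _).1 (I.ctr_mem _ _).1
  have h1 : ∀ x, I.value (I.expert h x) * I.ctr (I.expert h x) x ≤ 1 := fun x =>
    mul_le_one₀ (I.value_mem _).2 (I.ctr_mem _ _).1 (I.ctr_mem _ _).2
  refine ⟨integral_nonneg h0, ?_⟩
  have := integral_mono_of_nonneg (μ := (I.ctxLaw : Measure X)) (Filter.Eventually.of_forall h0)
    (integrable_const 1) (Filter.Eventually.of_forall h1)
  simpa [expertWelfare] using this

end Noise

/-! ### Concentration of the estimates -/

section Concentration

open ProbabilityTheory

/-- The Chernoff bound for sums of i.i.d. bounded random variables, realized as the coordinates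
of an infinite product. -/
lemma infinitePi_sum_ge_le {Ω : Type*} [MeasurableSpace Ω] (P : Measure Ω)
    [IsProbabilityMeasure P] {g : Ω → ℝ} (hg : Measurable g) {B : ℝ} (hB : ∀ ω, |g ω| ≤ B)
    (t : ℕ) (r : ℝ) :
    (Measure.infinitePi fun _ : ℕ => P).real {z | r ≤ ∑ i ∈ Finset.range t, g (z i)}
      ≤ Real.exp (-r) * (∫ ω, Real.exp (g ω) ∂P) ^ t := by
  set M := Measure.infinitePi fun _ : ℕ => P
  have hind : iIndepFun (fun (i : ℕ) (z : ℕ → Ω) => g (z i)) M :=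
    iIndepFun_infinitePi (X := fun _ => g) fun _ => hg
  have hmeas : ∀ i : ℕ, Measurable fun z : ℕ → Ω => g (z i) := fun i =>
    hg.comp (measurable_pi_apply i)
  have hmgf := hind.mgf_sum (t := 1) hmeas (Finset.range t)
  have hone : ∀ i : ℕ, mgf (fun z : ℕ → Ω => g (z i)) M 1 = ∫ ω, Real.exp (g ω) ∂P := by
    intro i
    have hpres := measurePreserving_eval_infinitePi (fun _ : ℕ => P) i
    simp only [mgf, one_mul]
    have := integral_map (μ := Measure.infinitePi fun _ : ℕ => P)
      (f := fun ω => Real.exp (g ω)) hpres.measurable.aemeasurable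
      (Real.measurable_exp.comp hg).aestronglyMeasurable
    rw [hpres.map_eq] at this
    exact this.symm
  simp only [hone, Finset.prod_const, Finset.card_range] at hmgf
  have hint : Integrable
      (fun z => Real.exp (1 * (∑ i ∈ Finset.range t, fun z : ℕ → Ω => g (z i)) z)) M := by
    refine Integrable.of_bound (C := Real.exp (t * B)) ?_ (Filter.Eventually.of_forall fun z => ?_)
    · simp only [Finset.sum_apply, one_mul]
      exact (Real.measurable_exp.comp
        (Finset.measurable_fun_sum _ fun i _ => hmeas i)).aestronglyMeasurable
    · rw [Real.norm_eq_abs, Real.abs_exp, Real.exp_le_exp, one_mul, Finset.sum_apply]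
      calc ∑ i ∈ Finset.range t, g (z i) ≤ ∑ i ∈ Finset.range t, B :=
            Finset.sum_le_sum fun i _ => (le_abs_self _).trans (hB _)
        _ = t * B := by simp
  have := measure_ge_le_exp_mul_mgf (μ := M) r zero_le_one hint
  rw [hmgf] at this
  simpa using this

variable {X : Type u} [MeasurableSpace X] {K m : ℕ}

lemma integral_exploreInd_mul [NeZero K] (I : Instance X K m) {ε : ℝ}
    (hε : ε ∈ Set.Icc (0 : ℝ) 1) (ψ : X × Fin K × unitInterval → ℝ) :
    ∫ z, exploreInd ε z * ψ (z.1, z.2.2) ∂(noiseLaw I) = ε * ∫ s, ψ s ∂(coinFreeLaw I) := by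
  have := integral_noise_mul I (fun u => if (u : ℝ) < ε then 1 else 0) ψ
  rw [integral_coin hε] at this
  simpa [exploreInd] using this

lemma integral_exp_exploreInd_mul [NeZero K] (I : Instance X K m) {ε : ℝ}
    (hε : ε ∈ Set.Icc (0 : ℝ) 1) {ψ : X × Fin K × unitInterval → ℝ} (hψ : Measurable ψ) {B : ℝ}
    (hB : ∀ s, |ψ s| ≤ B) :
    ∫ z, Real.exp (exploreInd ε z * ψ (z.1, z.2.2)) ∂(noiseLaw I)
      = 1 + ε * ((∫ s, Real.exp (ψ s) ∂(coinFreeLaw I)) - 1) := by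
  have hψi : Integrable (fun s => Real.exp (ψ s)) (coinFreeLaw I) :=
    Integrable.of_bound (C := Real.exp B) (Real.measurable_exp.comp hψ).aestronglyMeasurable
      (Filter.Eventually.of_forall fun s => by
        rw [Real.norm_eq_abs, Real.abs_exp, Real.exp_le_exp]
        exact (le_abs_self _).trans (hB s))
  have hexp : ∀ z : Noise X K, Real.exp (exploreInd ε z * ψ (z.1, z.2.2))
      = 1 + exploreInd ε z * (fun s => Real.exp (ψ s) - 1) (z.1, z.2.2) := by
    intro z
    unfold exploreInd
    split_ifs <;> simp
  have hpair : Measurable fun z : Noise X K => (z.1, z.2.2) :=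
    measurable_fst.prodMk measurable_snd.snd
  simp_rw [hexp]
  rw [integral_add (integrable_const _), integral_exploreInd_mul I hε
    (fun s => Real.exp (ψ s) - 1), integral_sub hψi (integrable_const _)]
  · simp
  · refine Integrable.of_bound (C := Real.exp B + 1) ((measurable_exploreInd ε).mul
      (((Real.measurable_exp.comp hψ).sub_const 1).comp hpair)).aestronglyMeasurable
      (Filter.Eventually.of_forall fun z => ?_)
    have h1 := exploreInd_mem ε z
    have h2 : |Real.exp (ψ (z.1, z.2.2)) - 1| ≤ Real.exp B + 1 := by
      have := Real.exp_le_exp.2 ((le_abs_self _).trans (hB (z.1, z.2.2)))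
      have := Real.exp_pos (ψ (z.1, z.2.2))
      rw [abs_le]; constructor <;> linarith
    rw [norm_mul, Real.norm_eq_abs, Real.norm_eq_abs, abs_of_nonneg h1.1]
    calc _ ≤ 1 * |Real.exp (ψ (z.1, z.2.2)) - 1| := by
          gcongr
          exact h1.2
      _ ≤ _ := by rw [one_mul]; exact h2

/-- Hoeffding's lemma, with the quadratic correction charged to explore rounds only. Summed over
the rounds, the exponent is self-normalized: its correction is proportional to the random number
of explore rounds. -/
lemma integral_exp_explored_deviation_le_one [NeZero K] (I : Instance X K m) {ε : ℝ}
    (hε : ε ∈ Set.Icc (0 : ℝ) 1) {f : X × Fin K × unitInterval → ℝ} (hf : Measurable f)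
    (hf01 : ∀ s, f s ∈ Set.Icc (0 : ℝ) 1) (s : ℝ) :
    ∫ z, Real.exp (exploreInd ε z
      * (s * (f (z.1, z.2.2) - ∫ q, f q ∂(coinFreeLaw I)) - s ^ 2 / 8)) ∂(noiseLaw I) ≤ 1 := by
  set p := ∫ q, f q ∂(coinFreeLaw I)
  have hsub := hasSubgaussianMGF_of_mem_Icc (μ := coinFreeLaw I) hf.aemeasurable
    (Filter.Eventually.of_forall hf01)
  have hmgf := hsub.mgf_le s
  rw [integral_exp_exploreInd_mul I hε (ψ := fun q => s * (f q - p) - s ^ 2 / 8)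
    (((hf.sub_const p).const_mul s).sub_const _) (B := |s| * (1 + |p|) + s ^ 2 / 8)]
  · have : ∫ q, Real.exp (s * (f q - p) - s ^ 2 / 8) ∂(coinFreeLaw I) ≤ 1 := by
      simp_rw [Real.exp_sub]
      rw [integral_div, div_le_one (Real.exp_pos _)]
      refine hmgf.trans (le_of_eq ?_)
      congr 1
      simp
      ring
    nlinarith [hε.1]
  · intro q
    have h1 : |f q - p| ≤ 1 + |p| := by
      have := abs_sub (f q) p
      have h2 := hf01 q
      rw [abs_of_nonneg h2.1] at this
      linarith [h2.2]
    calc _ ≤ |s * (f q - p)| + |s ^ 2 / 8| := abs_sub _ _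
      _ ≤ _ := by
        rw [abs_mul, abs_of_nonneg (by positivity : 0 ≤ s ^ 2 / 8)]
        gcongr

/-- The number of explore rounds among the first `t` rounds. -/
noncomputable def exploreCount (ε : ℝ) (z : ℕ → Noise X K) (t : ℕ) : ℝ :=
  ∑ i ∈ Finset.range t, exploreInd ε (z i)

/-- The centred sum of the samples of `f` over the explore rounds among the first `t` rounds. -/
noncomputable def exploredDeviation [NeZero K] (I : Instance X K m) (ε : ℝ)
    (f : X × Fin K × unitInterval → ℝ) (z : ℕ → Noise X K) (t : ℕ) : ℝ :=
  ∑ i ∈ Finset.range t,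
    exploreInd ε (z i) * (f ((z i).1, (z i).2.2) - ∫ q, f q ∂(coinFreeLaw I))

/-- The law of the noise of all rounds. -/
noncomputable def noisePath [NeZero K] (I : Instance X K m) : Measure (ℕ → Noise X K) :=
  Measure.infinitePi fun _ : ℕ => noiseLaw I

instance [NeZero K] (I : Instance X K m) : IsProbabilityMeasure (noisePath I) := by
  unfold noisePath
  infer_instance

lemma real_exploredDeviation_le [NeZero K] (I : Instance X K m) {ε : ℝ}
    (hε : ε ∈ Set.Icc (0 : ℝ) 1) {f : X × Fin K × unitInterval → ℝ} (hf : Measurable f)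
    (hf01 : ∀ s, f s ∈ Set.Icc (0 : ℝ) 1) (t : ℕ) (s r : ℝ) :
    (noisePath I).real {z | r ≤ s * exploredDeviation I ε f z t - s ^ 2 / 8 * exploreCount ε z t}
      ≤ Real.exp (-r) := by
  set p := ∫ q, f q ∂(coinFreeLaw I) with hp
  have hpair : Measurable fun z : Noise X K => (z.1, z.2.2) :=
    measurable_fst.prodMk measurable_snd.snd
  have key := infinitePi_sum_ge_le (noiseLaw I)
    (g := fun z => exploreInd ε z * (s * (f (z.1, z.2.2) - p) - s ^ 2 / 8))
    ((measurable_exploreInd ε).mul ((((hf.comp hpair).sub_const p).const_mul s).sub_const _))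
    (B := |s| * (1 + |p|) + s ^ 2 / 8) ?_ t r
  · have hset : {z : ℕ → Noise X K | r ≤ s * exploredDeviation I ε f z t
          - s ^ 2 / 8 * exploreCount ε z t}
        = {z | r ≤ ∑ i ∈ Finset.range t, exploreInd ε (z i)
          * (s * (f ((z i).1, (z i).2.2) - p) - s ^ 2 / 8)} := by
      ext z
      simp only [Set.mem_ofPred_eq, exploredDeviation, exploreCount, Finset.mul_sum,
        ← Finset.sum_sub_distrib]
      refine Eq.to_iff (congrArg _ (Finset.sum_congr rfl fun i _ => ?_))
      rw [← hp]
      ring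
    rw [hset]
    refine key.trans (mul_le_of_le_one_right (Real.exp_pos _).le (pow_le_one₀ ?_ ?_))
    · exact integral_nonneg fun _ => (Real.exp_pos _).le
    · exact integral_exp_explored_deviation_le_one I hε hf hf01 s
  · intro z
    have h0 := exploreInd_mem ε z
    have h1 : |f (z.1, z.2.2) - p| ≤ 1 + |p| := by
      have := abs_sub (f (z.1, z.2.2)) p
      have h2 := hf01 (z.1, z.2.2)
      rw [abs_of_nonneg h2.1] at this
      linarith [h2.2]
    rw [abs_mul, abs_of_nonneg h0.1]
    calc _ ≤ 1 * |s * (f (z.1, z.2.2) - p) - s ^ 2 / 8| := by gcongr; exact h0.2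
      _ ≤ |s * (f (z.1, z.2.2) - p)| + |s ^ 2 / 8| := by rw [one_mul]; exact abs_sub _ _
      _ ≤ _ := by
        rw [abs_mul, abs_of_nonneg (by positivity : 0 ≤ s ^ 2 / 8)]
        gcongr

/-- Hoeffding's inequality for the average of `f` over the explore rounds, whose number is random
but at least half its expectation. -/
lemma real_abs_exploredDeviation_gt_le [NeZero K] (I : Instance X K m) {ε : ℝ}
    (hε : ε ∈ Set.Icc (0 : ℝ) 1) {f : X × Fin K × unitInterval → ℝ} (hf : Measurable f)
    (hf01 : ∀ s, f s ∈ Set.Icc (0 : ℝ) 1) (t : ℕ) {δ : ℝ} (hδ : 0 ≤ δ) :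
    (noisePath I).real {z | t * ε / 2 ≤ exploreCount ε z t ∧
        δ * exploreCount ε z t < |exploredDeviation I ε f z t|}
      ≤ 2 * Real.exp (-(δ ^ 2 * (t * ε))) := by
  -- The Chernoff parameter `±4 * δ` is optimal for deviations of size `δ` per sample.
  have h1 := real_exploredDeviation_le I hε hf hf01 t (4 * δ) (δ ^ 2 * (t * ε))
  have h2 := real_exploredDeviation_le I hε hf hf01 t (-(4 * δ)) (δ ^ 2 * (t * ε))
  rw [two_mul]
  refine (measureReal_mono ?_).trans ((measureReal_union_le _ _).trans (add_le_add h1 h2))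
  rintro z ⟨hn, hd⟩
  have hδ2 := mul_le_mul_of_nonneg_left hn (sq_nonneg δ)
  rcases lt_abs.1 hd with h | h
  · left
    have := mul_le_mul_of_nonneg_left h.le hδ
    simp only [Set.mem_ofPred_eq]
    nlinarith
  · right
    have := mul_le_mul_of_nonneg_left h.le hδ
    simp only [Set.mem_ofPred_eq]
    nlinarith

/-- A Chernoff bound for the lower tail of the number of explore rounds, with exponential parameter
`-1`; the exponent `1/2 - exp (-1)` it yields exceeds `1/8`. -/
lemma real_exploreCount_lt_le [NeZero K] (I : Instance X K m) {ε : ℝ}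
    (hε : ε ∈ Set.Icc (0 : ℝ) 1) (t : ℕ) :
    (noisePath I).real {z | exploreCount ε z t < t * ε / 2} ≤ Real.exp (-(t * ε / 8)) := by
  have key := infinitePi_sum_ge_le (noiseLaw I) (g := fun z => exploreInd ε z * -1)
    ((measurable_exploreInd ε).mul_const _) (B := 1) ?_ t (-(t * ε / 2))
  · have hint := integral_exp_exploreInd_mul I hε (ψ := fun _ => -1) measurable_const
      (B := 1) (by simp)
    simp only [integral_const, probReal_univ, one_smul] at hint
    rw [hint] at key
    have hsub : {z : ℕ → Noise X K | exploreCount ε z t < t * ε / 2}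
        ⊆ {z | -(t * ε / 2) ≤ ∑ i ∈ Finset.range t, exploreInd ε (z i) * -1} := by
      intro z hz
      simp only [Set.mem_ofPred_eq, exploreCount, ← Finset.sum_mul] at hz ⊢
      linarith
    refine (measureReal_mono hsub).trans (key.trans ?_)
    have hexp : 0 < Real.exp (-1) := Real.exp_pos _
    have hexp2 := Real.exp_neg_one_lt_d9
    have hbase : 1 + ε * (Real.exp (-1) - 1) ≤ Real.exp (ε * (Real.exp (-1) - 1)) := by
      linarith [Real.add_one_le_exp (ε * (Real.exp (-1) - 1))]
    have hbase0 : 0 ≤ 1 + ε * (Real.exp (-1) - 1) := by nlinarith [hε.1, hε.2]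
    calc _ ≤ Real.exp (- -(t * ε / 2)) * Real.exp (ε * (Real.exp (-1) - 1)) ^ t := by gcongr
      _ = Real.exp (t * ε / 2 + t * (ε * (Real.exp (-1) - 1))) := by
        rw [← Real.exp_nat_mul, ← Real.exp_add, neg_neg]
      _ ≤ _ := by
        have : 0 ≤ t * ε := mul_nonneg (Nat.cast_nonneg _) hε.1
        rw [Real.exp_le_exp]
        nlinarith
  · intro z
    have := exploreInd_mem ε z
    rw [abs_le]; constructor <;> linarith [this.1, this.2]

end Concentration

/-! ### Measurability and independence along a run -/

section Run

lemma sum_exploreRounds {X : Type u} {K t : ℕ} (H : History X K t) (f : Fin t → ℝ) :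
    ∑ τ ∈ exploreRounds H, f τ = ∑ τ, if (H τ).explored = true then f τ else 0 := by
  rw [exploreRounds, Finset.sum_filter]

lemma card_exploreRounds {X : Type u} {K t : ℕ} (H : History X K t) :
    ((exploreRounds H).card : ℝ) = ∑ τ, if (H τ).explored = true then (1 : ℝ) else 0 := by
  rw [← sum_exploreRounds]
  simp

variable {X : Type u} [MeasurableSpace X] {K m : ℕ} {W : Type v} [MeasurableSpace W]

lemma measurable_estimate (I : Instance X K m) (t : ℕ) (a : Fin K) (h : Fin m) :
    Measurable fun H : History X K t => estimate I H a h := by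
  have hexp : ∀ τ : Fin t, MeasurableSet {H : History X K t | (H τ).explored = true} := fun τ =>
    measurableSet_eq_fun ((measurable_snd.fst).comp (measurable_pi_apply τ)) measurable_const
  have hhit : ∀ τ : Fin t, MeasurableSet {H : History X K t |
      I.expert h (H τ).context = a ∧ (H τ).arm = a ∧ (H τ).clicked = true} := by
    intro τ
    refine MeasurableSet.inter ?_ (MeasurableSet.inter ?_ ?_)
    · exact measurableSet_eq_fun ((I.expert_measurable h).comp
        (measurable_fst.comp (measurable_pi_apply τ))) measurable_const
    · exact measurableSet_eq_fun ((measurable_snd.snd.fst).comp (measurable_pi_apply τ))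
        measurable_const
    · exact measurableSet_eq_fun ((measurable_snd.snd.snd).comp (measurable_pi_apply τ))
        measurable_const
  unfold estimate
  simp_rw [sum_exploreRounds, card_exploreRounds]
  refine Measurable.div (Measurable.mul_const ?_ _) ?_
  · exact Finset.measurable_fun_sum _ fun τ _ => Measurable.ite (hexp τ)
      (Measurable.ite (hhit τ) measurable_const measurable_const) measurable_const
  · exact Finset.measurable_fun_sum _ fun τ _ => Measurable.ite (hexp τ)
      measurable_const measurable_const

lemma measurable_followed (I : Instance X K m) (S : ArgmaxRule m) (t : ℕ) :
    Measurable fun p : History X K t × (Fin K → ℝ) => followed I S p.1 p.2 := by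
  refine S.measurable.comp (measurable_pi_lambda _ fun h => ?_)
  exact Finset.measurable_fun_sum _ fun i _ => ((measurable_estimate I t i h).comp
    measurable_fst).mul ((measurable_pi_apply i).comp measurable_snd)

lemma measurable_expert_uncurry (I : Instance X K m) :
    Measurable fun p : Fin m × X => I.expert p.1 p.2 :=
  measurable_from_prod_countable_right fun h => I.expert_measurable h

lemma measurable_decide_lt {Ω : Type*} [MeasurableSpace Ω] {f g : Ω → ℝ} (hf : Measurable f)
    (hg : Measurable g) : Measurable fun ω => decide (f ω < g ω) := by
  have : (fun ω => decide (f ω < g ω)) = fun ω => if f ω < g ω then true else false := by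
    ext ω
    split_ifs with h <;> simp [h]
  rw [this]
  exact Measurable.ite (measurableSet_lt hf hg) measurable_const measurable_const

lemma measurable_playRound (I : Instance X K m) (S : ArgmaxRule m) (ε : ℝ) (t : ℕ) :
    Measurable fun p : (History X K t × (Fin K → ℝ)) × Noise X K =>
      playRound I S ε p.1.1 p.1.2 p.2 := by
  have hexp : Measurable fun p : (History X K t × (Fin K → ℝ)) × Noise X K =>
      decide ((p.2.2.1 : ℝ) < ε) :=
    measurable_decide_lt (measurable_subtype_coe.comp measurable_snd.snd.fst) measurable_const
  have harm : Measurable fun p : (History X K t × (Fin K → ℝ)) × Noise X K =>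
      if decide ((p.2.2.1 : ℝ) < ε) = true then p.2.2.2.1
        else I.expert (followed I S p.1.1 p.1.2) p.2.1 := by
    refine Measurable.ite (measurableSet_eq_fun hexp measurable_const)
      measurable_snd.snd.snd.fst ?_
    exact (measurable_expert_uncurry I).comp
      (((measurable_followed I S t).comp measurable_fst).prodMk measurable_snd.fst)
  refine measurable_snd.fst.prodMk (hexp.prodMk (harm.prodMk ?_))
  exact measurable_decide_lt (measurable_subtype_coe.comp measurable_snd.snd.snd.snd)
    ((measurable_ctr_uncurry I).comp (harm.prodMk measurable_snd.fst))

lemma measurable_history (I : Instance X K m) (S : ArgmaxRule m) (ε : ℝ)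
    (σ : BidStrategy W X K) (t : ℕ) :
    Measurable fun ω : W × (ℕ → Noise X K) => history I S ε σ ω.1 ω.2 t := by
  induction t with
  | zero => exact measurable_pi_lambda _ fun i => i.elim0
  | succ t ih =>
    refine measurable_pi_lambda _ fun i => ?_
    induction i using Fin.lastCases with
    | last =>
      simp only [history, Fin.snoc_last]
      exact (measurable_playRound I S ε t).comp ((ih.prodMk ((σ.measurable t).comp
        (measurable_fst.prodMk ih))).prodMk ((measurable_pi_apply t).comp measurable_snd))
    | cast i =>
      simp only [history, Fin.snoc_castSucc]
      exact (measurable_pi_apply i).comp ih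

lemma measurable_bids (I : Instance X K m) (S : ArgmaxRule m) (ε : ℝ)
    (σ : BidStrategy W X K) (t : ℕ) :
    Measurable fun ω : W × (ℕ → Noise X K) => bids I S ε σ ω.1 ω.2 t :=
  (σ.measurable t).comp (measurable_fst.prodMk (measurable_history I S ε σ t))

lemma measurable_outcome (I : Instance X K m) (S : ArgmaxRule m) (ε : ℝ)
    (σ : BidStrategy W X K) (t : ℕ) :
    Measurable fun ω : W × (ℕ → Noise X K) => outcome I S ε σ ω.1 ω.2 t :=
  (measurable_playRound I S ε t).comp (((measurable_history I S ε σ t).prodMk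
    (measurable_bids I S ε σ t)).prodMk ((measurable_pi_apply t).comp measurable_snd))

/-- The expert followed in round `t` of a run, should that round exploit. -/
noncomputable def followedAt (I : Instance X K m) (S : ArgmaxRule m) (ε : ℝ)
    (σ : BidStrategy W X K) (t : ℕ) (ω : W × (ℕ → Noise X K)) : Fin m :=
  followed I S (history I S ε σ ω.1 ω.2 t) (bids I S ε σ ω.1 ω.2 t)

lemma measurable_followedAt (I : Instance X K m) (S : ArgmaxRule m) (ε : ℝ)
    (σ : BidStrategy W X K) (t : ℕ) : Measurable (followedAt I S ε σ t) := by
  have h : Measurable fun ω : W × (ℕ → Noise X K) =>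
      (history I S ε σ ω.1 ω.2 t, bids I S ε σ ω.1 ω.2 t) :=
    (measurable_history I S ε σ t).prodMk (measurable_bids I S ε σ t)
  have e : followedAt I S ε σ t = (fun p : History X K t × (Fin K → ℝ) => followed I S p.1 p.2) ∘
      fun ω : W × (ℕ → Noise X K) => (history I S ε σ ω.1 ω.2 t, bids I S ε σ ω.1 ω.2 t) := by
    ext1 ω
    rw [Function.comp_apply, followedAt]
  rw [e]
  exact (measurable_followed I S t).comp h

lemma history_congr (I : Instance X K m) (S : ArgmaxRule m) (ε : ℝ) (σ : BidStrategy W X K)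
    (w : W) {z z' : ℕ → Noise X K} (t : ℕ) (h : ∀ i < t, z i = z' i) :
    history I S ε σ w z t = history I S ε σ w z' t := by
  induction t with
  | zero => rfl
  | succ t ih =>
    simp only [history, ih fun i hi => h i (hi.trans (Nat.lt_succ_self t)),
      h t (Nat.lt_succ_self t)]

/-- For a fixed seed, the expert followed in round `t` is a function of the noise of the earlier
rounds, hence independent of the noise of round `t`. -/
lemma indepFun_followedAt [NeZero K] (I : Instance X K m) (S : ArgmaxRule m) (ε : ℝ)
    (σ : BidStrategy W X K) (w : W) (t : ℕ) :
    ProbabilityTheory.IndepFun (fun z : ℕ → Noise X K => followedAt I S ε σ t (w, z))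
      (fun z => z t) (noisePath I) := by
  have hind : ProbabilityTheory.iIndepFun (fun (i : ℕ) (z : ℕ → Noise X K) => z i)
      (noisePath I) :=
    ProbabilityTheory.iIndepFun_infinitePi (X := fun _ => id) fun _ => measurable_id
  have hpair := hind.indepFun_finset (Finset.range t) {t} (by simp)
    fun i => measurable_pi_apply i
  obtain ⟨z₀⟩ : Nonempty (Noise X K) := nonempty_of_isProbabilityMeasure (noiseLaw I)
  -- Noise of the first `t` rounds, continued arbitrarily.
  let ext : (Finset.range t → Noise X K) → ℕ → Noise X K := fun y i =>
    if hi : i ∈ Finset.range t then y ⟨i, hi⟩ else z₀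
  have hext : Measurable ext := by
    refine measurable_pi_lambda _ fun i => ?_
    by_cases hi : i ∈ Finset.range t
    · simp only [ext, dif_pos hi]
      exact measurable_pi_apply _
    · simp only [ext, dif_neg hi]
      exact measurable_const
  have hlast : Measurable fun y : (({t} : Finset ℕ) → Noise X K) =>
      y ⟨t, Finset.mem_singleton_self t⟩ := measurable_pi_apply _
  have hcomp := hpair.comp
    (φ := fun y => followedAt I S ε σ t (w, ext y))
    (ψ := fun y : (({t} : Finset ℕ) → Noise X K) => y ⟨t, Finset.mem_singleton_self t⟩)
    ((measurable_followedAt I S ε σ t).comp (measurable_const.prodMk hext))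
    hlast
  convert hcomp using 1
  swap
  · rfl
  ext1 z
  simp only [Function.comp_apply, followedAt, bids]
  rw [history_congr I S ε σ w (z := z) t]
  intro i hi
  simp [ext, hi]

lemma one_sub_exploreInd_mul_followReward_mem (I : Instance X K m) (ε : ℝ) (h : Fin m)
    (z : Noise X K) :
    (1 - exploreInd ε z) * followReward I h (z.1, z.2.2) ∈ Set.Icc (0 : ℝ) 1 := by
  have h1 := exploreInd_mem ε z
  have h2 := followReward_mem I h (z.1, z.2.2)
  exact ⟨mul_nonneg (by linarith [h1.2]) h2.1,
    mul_le_one₀ (by linarith [h1.1]) h2.1 h2.2⟩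

lemma measurable_one_sub_exploreInd_mul_followReward (I : Instance X K m) (ε : ℝ) (h : Fin m) :
    Measurable fun z : Noise X K => (1 - exploreInd ε z) * followReward I h (z.1, z.2.2) :=
  ((measurable_exploreInd ε).const_sub 1).mul ((measurable_followReward I h).comp
    (measurable_fst.prodMk measurable_snd.snd))

lemma integrable_of_mem_Icc {Ω : Type*} [MeasurableSpace Ω] {P : Measure Ω} [IsFiniteMeasure P]
    {f : Ω → ℝ} (hf : Measurable f) (h : ∀ ω, f ω ∈ Set.Icc (0 : ℝ) 1) : Integrable f P :=
  Integrable.of_mem_Icc 0 1 hf.aemeasurable (Filter.Eventually.of_forall h)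

instance [NeZero K] (I : Instance X K m) (ν : ProbabilityMeasure W) :
    IsProbabilityMeasure (runLaw I ν) := by
  unfold runLaw
  infer_instance

lemma measurable_exploitReward (I : Instance X K m) (S : ArgmaxRule m) (ε : ℝ)
    (σ : BidStrategy W X K) (t : ℕ) :
    Measurable fun ω : W × (ℕ → Noise X K) => (1 - exploreInd ε (ω.2 t))
      * followReward I (followedAt I S ε σ t ω) ((ω.2 t).1, (ω.2 t).2.2) := by
  have hm : Measurable fun p : Fin m × Noise X K =>
      (1 - exploreInd ε p.2) * followReward I p.1 (p.2.1, p.2.2.2) :=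
    measurable_from_prod_countable_right
      fun h => measurable_one_sub_exploreInd_mul_followReward I ε h
  exact hm.comp ((measurable_followedAt I S ε σ t).prodMk
    ((measurable_pi_apply t).comp measurable_snd))

/-- The expected reward from exploiting in round `t`: conditionally on the past, the noise of the
round is fresh. -/
lemma integral_exploitReward [NeZero K] (I : Instance X K m) (S : ArgmaxRule m) {ε : ℝ}
    (hε : ε ∈ Set.Icc (0 : ℝ) 1) (ν : ProbabilityMeasure W) (σ : BidStrategy W X K) (t : ℕ) :
    ∫ ω, (1 - exploreInd ε (ω.2 t))
      * followReward I (followedAt I S ε σ t ω) ((ω.2 t).1, (ω.2 t).2.2) ∂(runLaw I ν)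
    = (1 - ε) * ∫ ω, expertWelfare I (followedAt I S ε σ t ω) ∂(runLaw I ν) := by
  have hmW : Measurable fun ω => expertWelfare I (followedAt I S ε σ t ω) :=
    (measurable_of_countable (expertWelfare I)).comp (measurable_followedAt I S ε σ t)
  have hi1 : Integrable (fun ω : W × (ℕ → Noise X K) => (1 - exploreInd ε (ω.2 t))
      * followReward I (followedAt I S ε σ t ω) ((ω.2 t).1, (ω.2 t).2.2)) (runLaw I ν) :=
    integrable_of_mem_Icc (measurable_exploitReward I S ε σ t)
      fun ω => one_sub_exploreInd_mul_followReward_mem I ε _ _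
  have hi2 : Integrable (fun ω => expertWelfare I (followedAt I S ε σ t ω)) (runLaw I ν) :=
    integrable_of_mem_Icc hmW fun ω => expertWelfare_mem I _
  unfold runLaw at hi1 hi2 ⊢
  rw [integral_prod _ hi1, integral_prod _ hi2, ← integral_const_mul]
  congr 1
  ext w
  change ∫ z, _ ∂(noisePath I) = (1 - ε) * ∫ z, _ ∂(noisePath I)
  set F : (ℕ → Noise X K) → Fin m := fun z => followedAt I S ε σ t (w, z) with hF
  have hFm : Measurable F := (measurable_followedAt I S ε σ t).comp measurable_prodMk_left
  let ind : Fin m → Fin m → ℝ := fun h h' => if h' = h then 1 else 0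
  have hindm : ∀ h, Measurable (ind h) := fun h => measurable_of_countable _
  have hind01 : ∀ h h', ind h h' ∈ Set.Icc (0 : ℝ) 1 := fun h h' => by
    simp only [ind]; split_ifs <;> norm_num
  -- Once the value `h` of the followed expert is fixed, past and present factorize.
  have hterm : ∀ h, ∫ z, ind h (F z) * ((1 - exploreInd ε (z t))
        * followReward I h ((z t).1, (z t).2.2)) ∂(noisePath I)
      = ∫ z, ind h (F z) * ((1 - ε) * expertWelfare I h) ∂(noisePath I) := by
    intro h
    have hm := measurable_one_sub_exploreInd_mul_followReward I ε h
    have hi := (indepFun_followedAt I S ε σ w t).comp (hindm h) hm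
    have := hi.integral_fun_mul_eq_mul_integral
      ((hindm h).comp hFm).aestronglyMeasurable
      (hm.comp (measurable_pi_apply t)).aestronglyMeasurable
    simp only [Function.comp_apply] at this
    rw [this, integral_mul_const]
    congr 1
    have hpres := measurePreserving_eval_infinitePi (fun _ : ℕ => noiseLaw I) t
    have h2 := integral_map (μ := noisePath I) (f := fun z : Noise X K =>
      (1 - exploreInd ε z) * followReward I h (z.1, z.2.2)) hpres.measurable.aemeasurable
      hm.aestronglyMeasurable
    rw [show Measure.map (Function.eval t) (noisePath I) = noiseLaw I from hpres.map_eq,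
      integral_exploit_reward I hε] at h2
    exact h2.symm
  have hdecomp : ∀ (G : Fin m → ℝ) (z : ℕ → Noise X K), G (F z) = ∑ h, ind h (F z) * G h := by
    intro G z
    simp [ind]
  calc ∫ z, (1 - exploreInd ε (z t)) * followReward I (F z) ((z t).1, (z t).2.2) ∂(noisePath I)
      = ∫ z, ∑ h, ind h (F z) * ((1 - exploreInd ε (z t))
          * followReward I h ((z t).1, (z t).2.2)) ∂(noisePath I) := by
        congr 1
        ext z
        exact hdecomp
          (fun h => (1 - exploreInd ε (z t)) * followReward I h ((z t).1, (z t).2.2)) z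
    _ = ∑ h, ∫ z, ind h (F z) * ((1 - ε) * expertWelfare I h) ∂(noisePath I) := by
        rw [integral_finsetSum]
        · exact Finset.sum_congr rfl fun h _ => hterm h
        · intro h _
          have hm := measurable_one_sub_exploreInd_mul_followReward I ε h
          refine integrable_of_mem_Icc (((hindm h).comp hFm).mul
            (hm.comp (measurable_pi_apply t))) fun z => ?_
          have h1 := hind01 h (F z)
          have h2 := one_sub_exploreInd_mul_followReward_mem I ε h (z t)
          exact ⟨mul_nonneg h1.1 h2.1, mul_le_one₀ h1.2 h2.1 h2.2⟩
    _ = ∫ z, ∑ h, ind h (F z) * ((1 - ε) * expertWelfare I h) ∂(noisePath I) := by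
        rw [integral_finsetSum]
        intro h _
        exact (integrable_of_mem_Icc ((hindm h).comp hFm) fun z => hind01 h (F z)).mul_const _
    _ = ∫ z, (1 - ε) * expertWelfare I (F z) ∂(noisePath I) := by
        congr 1
        ext z
        exact (hdecomp (fun h => (1 - ε) * expertWelfare I h) z).symm
    _ = _ := integral_const_mul _ _

end Run

/-! ### Regret of a single exploit round -/

section Gap

variable {X : Type u} [MeasurableSpace X] {K m : ℕ} {W : Type v} [MeasurableSpace W]

lemma sum_history (I : Instance X K m) (S : ArgmaxRule m) (ε : ℝ) (σ : BidStrategy W X K)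
    (w : W) (z : ℕ → Noise X K) (G : Round X K → ℝ) (t : ℕ) :
    ∑ τ, G (history I S ε σ w z t τ) = ∑ i ∈ Finset.range t, G (outcome I S ε σ w z i) := by
  induction t with
  | zero => simp
  | succ t ih =>
    rw [Fin.sum_univ_castSucc, Finset.sum_range_succ, ← ih]
    simp only [history, Fin.snoc_castSucc, Fin.snoc_last]
    rfl

lemma card_exploreRounds_history (I : Instance X K m) (S : ArgmaxRule m) (ε : ℝ)
    (σ : BidStrategy W X K) (w : W) (z : ℕ → Noise X K) (t : ℕ) :
    ((exploreRounds (history I S ε σ w z t)).card : ℝ) = exploreCount ε z t := by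
  rw [card_exploreRounds,
    sum_history I S ε σ w z (fun r => if r.explored = true then (1 : ℝ) else 0)]
  refine Finset.sum_congr rfl fun i _ => ?_
  simp [outcome, playRound, Round.explored, exploreInd]

lemma sum_mul_estimate_history (I : Instance X K m) (S : ArgmaxRule m) (ε : ℝ)
    (σ : BidStrategy W X K) (w : W) (z : ℕ → Noise X K) (t : ℕ) (h : Fin m) (c : Fin K → ℝ) :
    ∑ a, c a * estimate I (history I S ε σ w z t) a h
      = (∑ i ∈ Finset.range t, exploreInd ε (z i) * sample I h c ((z i).1, (z i).2.2)) * K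
        / exploreCount ε z t := by
  unfold estimate
  rw [card_exploreRounds_history]
  simp_rw [sum_exploreRounds]
  simp_rw [mul_div_assoc, ← mul_assoc]
  rw [← Finset.sum_mul]
  congr 1
  simp_rw [Finset.mul_sum]
  rw [Finset.sum_comm]
  rw [sum_history I S ε σ w z (fun r => ∑ a, c a * if r.explored = true then
    (if I.expert h r.context = a ∧ r.arm = a ∧ r.clicked = true then (1 : ℝ) else 0) else 0)]
  refine Finset.sum_congr rfl fun i _ => ?_
  by_cases hx : ((z i).2.1 : ℝ) < ε
  · simp only [outcome, playRound, Round.explored, Round.context, Round.arm, Round.clicked,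
      exploreInd, sample, hx, decide_true, if_true, decide_eq_true_eq, one_mul]
    rw [Finset.sum_eq_single (z i).2.2.1]
    · simp
    · intro a _ ha
      simp [ha.symm]
    · simp
  · simp [outcome, playRound, Round.explored, exploreInd, hx]

/-- The weights for which the estimates have to be accurate: the indicator of each arm, for the
agents' incentives, and the values, for the welfare. Treating the values as one more weight avoids
summing the errors of `K` arms. -/
noncomputable def weight (I : Instance X K m) : Option (Fin K) → Fin K → ℝ
  | none => I.value
  | some a => Pi.single a 1

lemma weight_mem (I : Instance X K m) (o : Option (Fin K)) (a : Fin K) :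
    weight I o a ∈ Set.Icc (0 : ℝ) 1 := by
  cases o with
  | none => exact I.value_mem a
  | some b =>
    simp only [weight, Pi.single_apply]
    split_ifs <;> norm_num

/-- After `t` rounds there have been enough explore rounds, and the average of every relevant
sample over them is within `δ` of its mean. -/
def IsAccurate [NeZero K] (I : Instance X K m) (ε δ : ℝ) (t : ℕ) (z : ℕ → Noise X K) : Prop :=
  t * ε / 2 ≤ exploreCount ε z t ∧ ∀ (h : Fin m) (o : Option (Fin K)),
    |exploredDeviation I ε (sample I h (weight I o)) z t| ≤ δ * exploreCount ε z t

lemma measurable_exploreCount (ε : ℝ) (t : ℕ) :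
    Measurable fun z : ℕ → Noise X K => exploreCount ε z t :=
  Finset.measurable_fun_sum _ fun i _ => (measurable_exploreInd ε).comp (measurable_pi_apply i)

lemma measurable_exploredDeviation [NeZero K] (I : Instance X K m) (ε : ℝ)
    {f : X × Fin K × unitInterval → ℝ} (hf : Measurable f) (t : ℕ) :
    Measurable fun z : ℕ → Noise X K => exploredDeviation I ε f z t := by
  have hm : Measurable fun z : Noise X K =>
      exploreInd ε z * (f (z.1, z.2.2) - ∫ q, f q ∂(coinFreeLaw I)) :=
    (measurable_exploreInd ε).mul
      ((hf.comp (measurable_fst.prodMk measurable_snd.snd)).sub_const _)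
  exact Finset.measurable_fun_sum _ fun i _ => hm.comp (measurable_pi_apply i)

lemma measurableSet_isAccurate [NeZero K] (I : Instance X K m) (ε δ : ℝ) (t : ℕ) :
    MeasurableSet {z | IsAccurate I ε δ t z} := by
  have hset : {z | IsAccurate I ε δ t z} = {z | t * ε / 2 ≤ exploreCount ε z t} ∩
      ⋂ (h : Fin m) (o : Option (Fin K)),
        {z | |exploredDeviation I ε (sample I h (weight I o)) z t| ≤ δ * exploreCount ε z t} := by
    ext z
    simp [IsAccurate]
  rw [hset]
  refine (measurableSet_le measurable_const (measurable_exploreCount ε t)).inter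
    (MeasurableSet.iInter fun h => MeasurableSet.iInter fun o => ?_)
  exact measurableSet_le
    (measurable_exploredDeviation I ε (measurable_sample I h _) t).abs
    ((measurable_exploreCount ε t).const_mul δ)

lemma real_not_isAccurate_le [NeZero K] (I : Instance X K m) {ε : ℝ}
    (hε : ε ∈ Set.Icc (0 : ℝ) 1) {δ : ℝ} (hδ : 0 ≤ δ) (t : ℕ) :
    (noisePath I).real {z | ¬ IsAccurate I ε δ t z}
      ≤ Real.exp (-(t * ε / 8)) + m * (K + 1) * (2 * Real.exp (-(δ ^ 2 * (t * ε)))) := by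
  have hsub : {z | ¬ IsAccurate I ε δ t z} ⊆ {z | exploreCount ε z t < t * ε / 2} ∪
      ⋃ p : Fin m × Option (Fin K), {z | t * ε / 2 ≤ exploreCount ε z t ∧
        δ * exploreCount ε z t
          < |exploredDeviation I ε (sample I p.1 (weight I p.2)) z t|} := by
    intro z hz
    by_cases hn : t * ε / 2 ≤ exploreCount ε z t
    · right
      simp only [IsAccurate, Set.mem_ofPred_eq, hn, true_and, not_forall, not_le] at hz
      obtain ⟨h, o, ho⟩ := hz
      exact Set.mem_iUnion.2 ⟨(h, o), hn, ho⟩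
    · exact Or.inl (not_le.1 hn)
  refine (measureReal_mono hsub).trans ((measureReal_union_le _ _).trans
    (add_le_add (real_exploreCount_lt_le I hε t) ((measureReal_iUnion_fintype_le _).trans ?_)))
  refine (Finset.sum_le_sum fun p _ => real_abs_exploredDeviation_gt_le I hε
    (measurable_sample I p.1 _) (sample_mem I p.1 (weight_mem I p.2)) t hδ).trans ?_
  simp

lemma IsAccurate.abs_sum_mul_estimate_sub_le [NeZero K] {I : Instance X K m} {ε δ : ℝ} {t : ℕ}
    {z : ℕ → Noise X K} (hz : IsAccurate I ε δ t z) (ht : 0 < t * ε) (S : ArgmaxRule m)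
    (σ : BidStrategy W X K) (w : W) (h : Fin m) (o : Option (Fin K)) :
    |∑ a, weight I o a * estimate I (history I S ε σ w z t) a h
      - ∑ a, weight I o a * clickProb I a h| ≤ K * δ := by
  have hn : 0 < exploreCount ε z t := by linarith [hz.1]
  have hK : (0 : ℝ) < K := by exact_mod_cast Nat.pos_of_ne_zero (NeZero.ne K)
  have hdev := hz.2 h o
  have hmean := integral_sample I h (weight_mem I o)
  have key : ∑ a, weight I o a * estimate I (history I S ε σ w z t) a h
      - ∑ a, weight I o a * clickProb I a h
      = K * exploredDeviation I ε (sample I h (weight I o)) z t / exploreCount ε z t := by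
    rw [sum_mul_estimate_history, exploredDeviation, hmean]
    simp_rw [mul_sub, Finset.sum_sub_distrib]
    rw [← Finset.sum_mul]
    rw [show ∑ i ∈ Finset.range t, exploreInd ε (z i) = exploreCount ε z t from rfl]
    field_simp
  rw [key, abs_div, abs_mul, abs_of_pos hn, abs_of_pos hK, div_le_iff₀ hn]
  nlinarith

lemma bestWelfare_mem (I : Instance X K m) (S : ArgmaxRule m) :
    bestWelfare I ∈ Set.Icc (0 : ℝ) 1 := by
  have : Nonempty (Fin m) := ⟨S.pick 0⟩
  refine ⟨Real.iSup_nonneg fun h => (expertWelfare_mem I h).1,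
    ciSup_le fun h => (expertWelfare_mem I h).2⟩

/-- In a round with accurate estimates every `α`-rational agent is truthful, so the followed expert
maximizes an accurate estimate of the welfare. -/
lemma bestWelfare_sub_followedAt_le [NeZero K] {I : Instance X K m} {S : ArgmaxRule m} {ε δ α : ℝ}
    {σ : BidStrategy W X K} {t : ℕ} {ω : W × (ℕ → Noise X K)}
    (hz : IsAccurate I ε δ t ω.2) (ht : 0 < t * ε) (hα : 2 * (K * δ) ≤ α)
    (hrat : ∀ a : Fin K, (∀ y ∈ Set.Icc (0 : ℝ) 1,
      utility I S (history I S ε σ ω.1 ω.2 t) (bids I S ε σ ω.1 ω.2 t) a y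
        - utility I S (history I S ε σ ω.1 ω.2 t) (bids I S ε σ ω.1 ω.2 t) a (I.value a) ≤ α) →
      bids I S ε σ ω.1 ω.2 t a = I.value a) :
    bestWelfare I - expertWelfare I (followedAt I S ε σ t ω) ≤ 2 * (K * δ) := by
  have hacc := fun h o => hz.abs_sum_mul_estimate_sub_le ht S σ ω.1 h o
  have hbids : bids I S ε σ ω.1 ω.2 t = I.value := by
    ext a
    refine hrat a fun y hy => (utility_sub_le I S _ _ a (D := K * δ) (fun h => ?_) hy).trans hα
    simpa [weight, Pi.single_apply] using hacc h (some a)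
  have hmax : ∀ h, ∑ a, I.value a * estimate I (history I S ε σ ω.1 ω.2 t) a h
      ≤ ∑ a, I.value a * estimate I (history I S ε σ ω.1 ω.2 t) a (followedAt I S ε σ t ω) := by
    intro h
    have := S.isMax (fun h => ∑ i, estimate I (history I S ε σ ω.1 ω.2 t) i h * I.value i) h
    rw [followedAt, hbids]
    simp_rw [mul_comm (I.value _)]
    exact this
  have : Nonempty (Fin m) := ⟨S.pick 0⟩
  rw [sub_le_iff_le_add]
  refine ciSup_le fun h => ?_
  have h1 := abs_le.1 (hacc h none)
  have h2 := abs_le.1 (hacc (followedAt I S ε σ t ω) none)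
  simp only [weight, sum_value_mul_clickProb] at h1 h2
  linarith [hmax h, h1.1, h2.2]

lemma integrable_expertWelfare_followedAt [NeZero K] (I : Instance X K m) (S : ArgmaxRule m)
    (ε : ℝ) (ν : ProbabilityMeasure W) (σ : BidStrategy W X K) (t : ℕ) :
    Integrable (fun ω => expertWelfare I (followedAt I S ε σ t ω)) (runLaw I ν) :=
  integrable_of_mem_Icc ((measurable_of_countable (expertWelfare I)).comp
    (measurable_followedAt I S ε σ t)) fun _ => expertWelfare_mem I _

lemma integral_bestWelfare_sub_followedAt_le_one [NeZero K] (I : Instance X K m)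
    (S : ArgmaxRule m) (ε : ℝ) (ν : ProbabilityMeasure W) (σ : BidStrategy W X K) (t : ℕ) :
    ∫ ω, (bestWelfare I - expertWelfare I (followedAt I S ε σ t ω)) ∂(runLaw I ν) ≤ 1 := by
  have := integral_mono (μ := runLaw I ν) ((integrable_const _).sub
    (integrable_expertWelfare_followedAt I S ε ν σ t)) (integrable_const 1) (fun ω => by
      have h1 := (expertWelfare_mem I (followedAt I S ε σ t ω)).1
      have h2 := (bestWelfare_mem I S).2
      simp only [Pi.sub_apply]
      linarith)
  simpa using this

lemma integral_bestWelfare_sub_followedAt_le [NeZero K] {I : Instance X K m}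
    {S : ArgmaxRule m} {ε δ α : ℝ} (hε : ε ∈ Set.Icc (0 : ℝ) 1) (hδ : 0 ≤ δ)
    {ν : ProbabilityMeasure W} {σ : BidStrategy W X K} {T t : ℕ}
    (hrat : AlphaRational I S ε ν σ T α) (htT : t < T) (ht : 0 < t * ε)
    (hα : 2 * (K * δ) ≤ α) :
    ∫ ω, (bestWelfare I - expertWelfare I (followedAt I S ε σ t ω)) ∂(runLaw I ν)
      ≤ 2 * (K * δ) + (Real.exp (-(t * ε / 8))
        + m * (K + 1) * (2 * Real.exp (-(δ ^ 2 * (t * ε))))) := by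
  set bad : Set (W × (ℕ → Noise X K)) := Prod.snd ⁻¹' {z | ¬ IsAccurate I ε δ t z} with hbad
  have hsetm : MeasurableSet {z | ¬ IsAccurate I ε δ t z} :=
    (measurableSet_isAccurate I ε δ t).compl
  have hbadm : MeasurableSet bad := measurable_snd hsetm
  have hpres : MeasurePreserving (Prod.snd : W × (ℕ → Noise X K) → _) (runLaw I ν)
      (noisePath I) := measurePreserving_snd
  have hbadP : (runLaw I ν).real bad = (noisePath I).real {z | ¬ IsAccurate I ε δ t z} :=
    hpres.measureReal_preimage hsetm.nullMeasurableSet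
  have hint : Integrable (bad.indicator fun _ => (1 : ℝ)) (runLaw I ν) :=
    (integrable_const _).indicator hbadm
  calc _ ≤ ∫ ω, (2 * (K * δ) + bad.indicator (fun _ => (1 : ℝ)) ω) ∂(runLaw I ν) := by
        refine integral_mono_ae ((integrable_const _).sub
          (integrable_expertWelfare_followedAt I S ε ν σ t)) ((integrable_const _).add hint) ?_
        filter_upwards [hrat] with ω hω
        by_cases hz : IsAccurate I ε δ t ω.2
        · have : ω ∉ bad := by simpa [bad] using hz
          simpa [this] using bestWelfare_sub_followedAt_le hz ht hα (hω t htT)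
        · have : ω ∈ bad := by simpa [bad] using hz
          have h1 := (expertWelfare_mem I (followedAt I S ε σ t ω)).1
          have h2 := (bestWelfare_mem I S).2
          have h3 : 0 ≤ 2 * (K * δ) := by positivity
          simp only [this, Set.indicator_of_mem]
          linarith
    _ = 2 * (K * δ) + (runLaw I ν).real bad := by
        rw [integral_add (integrable_const _) hint, integral_indicator_const _ hbadm]
        simp
    _ ≤ _ := by
        rw [hbadP]
        gcongr
        exact real_not_isAccurate_le I hε hδ t

lemma exploitReward_le (I : Instance X K m) (S : ArgmaxRule m) (ε : ℝ) (σ : BidStrategy W X K)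
    (t : ℕ) (ω : W × (ℕ → Noise X K)) :
    (1 - exploreInd ε (ω.2 t))
      * followReward I (followedAt I S ε σ t ω) ((ω.2 t).1, (ω.2 t).2.2)
    ≤ (if (outcome I S ε σ ω.1 ω.2 t).clicked = true then (1 : ℝ) else 0)
        * I.value (outcome I S ε σ ω.1 ω.2 t).arm := by
  by_cases hx : ((ω.2 t).2.1 : ℝ) < ε
  · have : 0 ≤ (if (outcome I S ε σ ω.1 ω.2 t).clicked = true then (1 : ℝ) else 0)
        * I.value (outcome I S ε σ ω.1 ω.2 t).arm :=
      mul_nonneg (by split_ifs <;> norm_num) (I.value_mem _).1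
    simpa [exploreInd, hx] using this
  · simp [exploreInd, hx, outcome, playRound, followReward, Round.clicked, Round.arm, followedAt]
    exact le_rfl

lemma reward_mem (I : Instance X K m) (S : ArgmaxRule m) (ε : ℝ) (σ : BidStrategy W X K)
    (t : ℕ) (ω : W × (ℕ → Noise X K)) :
    (if (outcome I S ε σ ω.1 ω.2 t).clicked = true then (1 : ℝ) else 0)
        * I.value (outcome I S ε σ ω.1 ω.2 t).arm ∈ Set.Icc (0 : ℝ) 1 := by
  have := I.value_mem (outcome I S ε σ ω.1 ω.2 t).arm
  split_ifs
  · simpa using this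
  · simp

lemma integrable_reward [NeZero K] (I : Instance X K m) (S : ArgmaxRule m) (ε : ℝ)
    (ν : ProbabilityMeasure W) (σ : BidStrategy W X K) (t : ℕ) :
    Integrable (fun ω => (if (outcome I S ε σ ω.1 ω.2 t).clicked = true then (1 : ℝ) else 0)
        * I.value (outcome I S ε σ ω.1 ω.2 t).arm) (runLaw I ν) := by
  have ho := measurable_outcome I S ε σ t
  refine integrable_of_mem_Icc (Measurable.mul (Measurable.ite ?_ measurable_const
    measurable_const) ((measurable_of_countable I.value).comp (measurable_snd.snd.fst.comp ho)))
    (reward_mem I S ε σ t)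
  exact measurableSet_eq_fun (measurable_snd.snd.snd.comp ho) measurable_const

lemma integrable_regret [NeZero K] (I : Instance X K m) (S : ArgmaxRule m) (ε : ℝ)
    (ν : ProbabilityMeasure W) (σ : BidStrategy W X K) (T : ℕ) :
    Integrable (regret I S ε σ T) (runLaw I ν) :=
  (integrable_const _).sub (integrable_finsetSum _ fun t _ => integrable_reward I S ε ν σ t)

lemma integral_regret_eq [NeZero K] (I : Instance X K m) (S : ArgmaxRule m) (ε : ℝ)
    (ν : ProbabilityMeasure W) (σ : BidStrategy W X K) (T : ℕ) :
    ∫ ω, regret I S ε σ T ω ∂(runLaw I ν)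
      = ∑ t ∈ Finset.range T, (bestWelfare I - ∫ ω,
        (if (outcome I S ε σ ω.1 ω.2 t).clicked = true then (1 : ℝ) else 0)
          * I.value (outcome I S ε σ ω.1 ω.2 t).arm ∂(runLaw I ν)) := by
  unfold regret
  rw [integral_sub (integrable_const _)
    (integrable_finsetSum _ fun t _ => integrable_reward I S ε ν σ t),
    integral_finsetSum _ fun t _ => integrable_reward I S ε ν σ t, Finset.sum_sub_distrib]
  simp

lemma integral_regret_le_card [NeZero K] (I : Instance X K m) (S : ArgmaxRule m) (ε : ℝ)
    (ν : ProbabilityMeasure W) (σ : BidStrategy W X K) (T : ℕ) :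
    ∫ ω, regret I S ε σ T ω ∂(runLaw I ν) ≤ T := by
  rw [integral_regret_eq]
  refine (Finset.sum_le_sum (g := fun _ => (1 : ℝ)) fun t _ => ?_).trans (by simp)
  have h1 := (bestWelfare_mem I S).2
  have h2 : 0 ≤ ∫ ω, (if (outcome I S ε σ ω.1 ω.2 t).clicked = true then (1 : ℝ) else 0)
      * I.value (outcome I S ε σ ω.1 ω.2 t).arm ∂(runLaw I ν) :=
    integral_nonneg fun ω => (reward_mem I S ε σ t ω).1
  linarith

/-- Explore rounds cost at most one each, and exploit rounds the welfare gap of the followed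
expert. -/
lemma integral_regret_le_sum [NeZero K] (I : Instance X K m) (S : ArgmaxRule m) {ε : ℝ}
    (hε : ε ∈ Set.Icc (0 : ℝ) 1) (ν : ProbabilityMeasure W) (σ : BidStrategy W X K) (T : ℕ) :
    ∫ ω, regret I S ε σ T ω ∂(runLaw I ν)
      ≤ T * ε + ∑ t ∈ Finset.range T,
        ∫ ω, (bestWelfare I - expertWelfare I (followedAt I S ε σ t ω)) ∂(runLaw I ν) := by
  have hconst : (T : ℝ) * ε = ∑ _t ∈ Finset.range T, ε := by simp
  rw [integral_regret_eq, hconst, ← Finset.sum_add_distrib]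
  refine Finset.sum_le_sum fun t _ => ?_
  have h1 := integral_mono (integrable_of_mem_Icc (P := runLaw I ν)
    (measurable_exploitReward I S ε σ t)
    fun ω => one_sub_exploreInd_mul_followReward_mem I ε _ _)
    (integrable_reward I S ε ν σ t) (exploitReward_le I S ε σ t)
  rw [integral_exploitReward I S hε] at h1
  have hi := integrable_expertWelfare_followedAt I S ε ν σ t
  rw [integral_sub (integrable_const _) hi]
  have h2 : ∫ ω, expertWelfare I (followedAt I S ε σ t ω) ∂(runLaw I ν) ≤ 1 := by
    have := integral_mono hi (integrable_const 1) fun ω =>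
      (expertWelfare_mem I (followedAt I S ε σ t ω)).2
    simpa using this
  simp only [integral_const, probReal_univ, one_smul]
  nlinarith [hε.1]

end Gap

/-! ### Summing the regret over the rounds -/

section Total

variable {X : Type u} [MeasurableSpace X] {K m : ℕ} {W : Type v} [MeasurableSpace W]

/-- With a single arm every round collects the optimal welfare in expectation. -/
lemma integral_regret_eq_zero_of_subsingleton [NeZero K] [Subsingleton (Fin K)]
    (I : Instance X K m) (S : ArgmaxRule m) (ε : ℝ) (ν : ProbabilityMeasure W)
    (σ : BidStrategy W X K) (T : ℕ) :
    ∫ ω, regret I S ε σ T ω ∂(runLaw I ν) = 0 := by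
  rw [integral_regret_eq]
  refine Finset.sum_eq_zero fun t _ => ?_
  set h := S.pick 0
  have hbest : bestWelfare I = expertWelfare I h := by
    have : Nonempty (Fin m) := ⟨h⟩
    have hall : ∀ h', expertWelfare I h' = expertWelfare I h := fun h' => by
      unfold expertWelfare
      congr 1
      ext x
      rw [Subsingleton.elim (I.expert h' x) (I.expert h x)]
    unfold bestWelfare
    simp [hall]
  have hreward : ∀ ω : W × (ℕ → Noise X K),
      (if (outcome I S ε σ ω.1 ω.2 t).clicked = true then (1 : ℝ) else 0)
        * I.value (outcome I S ε σ ω.1 ω.2 t).arm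
      = followReward I h ((ω.2 t).1, (ω.2 t).2.2) := by
    intro ω
    have harm : (outcome I S ε σ ω.1 ω.2 t).arm = I.expert h (ω.2 t).1 := Subsingleton.elim _ _
    have hclick : (outcome I S ε σ ω.1 ω.2 t).clicked
        = decide (((ω.2 t).2.2.2 : ℝ) < I.ctr (outcome I S ε σ ω.1 ω.2 t).arm (ω.2 t).1) := rfl
    rw [hclick, harm]
    simp [followReward]
  have hpair : Measurable fun z : Noise X K => (z.1, z.2.2) :=
    measurable_fst.prodMk measurable_snd.snd
  have hpres : MeasurePreserving (fun ω : W × (ℕ → Noise X K) => ω.2 t) (runLaw I ν)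
      (noiseLaw I) :=
    (measurePreserving_eval_infinitePi (fun _ : ℕ => noiseLaw I) t).comp measurePreserving_snd
  have hmap := integral_map (μ := runLaw I ν) (f := fun z : Noise X K =>
    followReward I h (z.1, z.2.2)) hpres.measurable.aemeasurable
    ((measurable_followReward I h).comp hpair).aestronglyMeasurable
  have hnoise := integral_noise_mul I (fun _ => 1) (followReward I h)
  rw [hpres.map_eq] at hmap
  simp only [integral_const, probReal_univ, one_smul, one_mul, integral_followReward] at hnoise
  simp_rw [hreward]
  rw [hbest, ← hmap, hnoise, sub_self]

lemma sum_range_one_div_sqrt_le (T : ℕ) :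
    ∑ t ∈ Finset.range T, 1 / Real.sqrt t ≤ 2 * Real.sqrt T := by
  have key : ∀ n : ℕ, ∑ t ∈ Finset.range (n + 1), 1 / Real.sqrt t ≤ 2 * Real.sqrt n := by
    intro n
    induction n with
    | zero => simp
    | succ n ih =>
      rw [Finset.sum_range_succ]
      have hpos : 0 < Real.sqrt ((n + 1 : ℕ) : ℝ) := Real.sqrt_pos.2 (by positivity)
      have h0 := Real.sqrt_nonneg (n : ℝ)
      have h1 := Real.sq_sqrt (Nat.cast_nonneg (α := ℝ) n)
      have h2 := Real.sq_sqrt (Nat.cast_nonneg (α := ℝ) (n + 1))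
      have h3 : 1 / Real.sqrt ((n + 1 : ℕ) : ℝ)
          ≤ 2 * (Real.sqrt ((n + 1 : ℕ) : ℝ) - Real.sqrt n) := by
        rw [div_le_iff₀ hpos]
        have h4 : ((n + 1 : ℕ) : ℝ) = n + 1 := by push_cast; ring
        nlinarith [sq_nonneg (Real.sqrt ((n + 1 : ℕ) : ℝ) - Real.sqrt n)]
      linarith
  cases T with
  | zero => simp
  | succ n =>
    refine (key n).trans ?_
    gcongr
    simp

lemma sum_range_ite_lt_le (T : ℕ) {x : ℝ} (hx : 0 ≤ x) :
    ∑ t ∈ Finset.range T, (if (t : ℝ) < x then (1 : ℝ) else 0) ≤ x + 1 := by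
  rw [← Finset.sum_filter, Finset.sum_const, nsmul_eq_mul, mul_one]
  have hsub : (Finset.range T).filter (fun t : ℕ => (t : ℝ) < x) ⊆ Finset.range ⌈x⌉₊ := by
    intro t ht
    rw [Finset.mem_filter] at ht
    exact Finset.mem_range.2 (Nat.lt_ceil.2 ht.2)
  have h1 := Finset.card_le_card hsub
  rw [Finset.card_range] at h1
  exact (Nat.cast_le.2 h1).trans (Nat.ceil_lt_add_one hx).le

/-- The welfare gap of an exploit round. Before the threshold it is bounded by one. From then on
the accuracy `δ = √(2 L / (t ε))` with `L = log (T m K)` is fine enough for `α`-rational agents to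
be truthful, and too few explore rounds or a given inaccurate estimate each have probability of
order at most `(T m K)⁻²`. -/
lemma integral_bestWelfare_sub_followedAt_le_of_two_le [NeZero K] {I : Instance X K m}
    {S : ArgmaxRule m} {ε α : ℝ} (hε : ε ∈ Set.Ioc (0 : ℝ) 1) (hα : α ∈ Set.Ioc (0 : ℝ) 1)
    {ν : ProbabilityMeasure W} {σ : BidStrategy W X K} {T t : ℕ}
    (hrat : AlphaRational I S ε ν σ T α) (htT : t < T) (hK : 2 ≤ K) {L : ℝ} (hL : 0 < L) :
    ∫ ω, (bestWelfare I - expertWelfare I (followedAt I S ε σ t ω)) ∂(runLaw I ν)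
      ≤ (if (t : ℝ) < 8 * (K : ℝ) ^ 2 * L / (ε * α ^ 2) then 1 else 0)
        + 2 * K * Real.sqrt (2 * L / ε) * (1 / Real.sqrt t)
        + (1 + 2 * (m * (K + 1))) * Real.exp (-(2 * L)) := by
  obtain ⟨hε0, hε1⟩ := hε
  obtain ⟨hα0, hα1⟩ := hα
  have hK' : (2 : ℝ) ≤ K := by exact_mod_cast hK
  split_ifs with hlt
  · have h1 := integral_bestWelfare_sub_followedAt_le_one I S ε ν σ t
    have h2 : 0 ≤ 2 * K * Real.sqrt (2 * L / ε) * (1 / Real.sqrt t) := by positivity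
    have h3 : 0 ≤ (1 + 2 * ((m : ℝ) * (K + 1))) * Real.exp (-(2 * L)) := by positivity
    linarith
  · have hge : 8 * (K : ℝ) ^ 2 * L ≤ t * ε * α ^ 2 := by
      rw [not_lt, div_le_iff₀ (by positivity)] at hlt
      linarith
    have htε : 0 < t * ε := by
      by_contra! hneg
      have : 0 < 8 * (K : ℝ) ^ 2 * L := by positivity
      nlinarith [sq_nonneg α]
    have ht : (0 : ℝ) < t := by
      by_contra! hneg
      nlinarith
    set δ := Real.sqrt (2 * L / (t * ε)) with hδdef
    have hδ2 : δ ^ 2 * (t * ε) = 2 * L := by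
      rw [hδdef, Real.sq_sqrt (by positivity), div_mul_cancel₀ _ htε.ne']
    have hδα : 2 * (K * δ) ≤ α := by
      refine abs_le_of_sq_le_sq' ?_ hα0.le |>.2
      have h1 : (2 * (K * δ)) ^ 2 * (t * ε) ≤ α ^ 2 * (t * ε) := by
        calc (2 * (K * δ)) ^ 2 * (t * ε) = 4 * (K : ℝ) ^ 2 * (δ ^ 2 * (t * ε)) := by ring
          _ ≤ α ^ 2 * (t * ε) := by rw [hδ2]; linarith
      exact le_of_mul_le_mul_right h1 htε
    have hδsplit : δ = Real.sqrt (2 * L / ε) * (1 / Real.sqrt t) := by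
      rw [hδdef, mul_one_div, ← Real.sqrt_div (by positivity), div_div, mul_comm (t : ℝ) ε]
    have hmain := integral_bestWelfare_sub_followedAt_le ⟨hε0.le, hε1⟩ (Real.sqrt_nonneg _)
      hrat htT htε hδα
    rw [hδ2] at hmain
    have hexp : Real.exp (-(t * ε / 8)) ≤ Real.exp (-(2 * L)) := by
      rw [Real.exp_le_exp]
      have h1 : α ^ 2 ≤ 1 := pow_le_one₀ hα0.le hα1
      have h2 : t * ε * α ^ 2 ≤ t * ε := mul_le_of_le_one_right htε.le h1
      have h3 : 4 * L ≤ (K : ℝ) ^ 2 * L := by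
        gcongr
        nlinarith
      linarith
    calc _ ≤ _ := hmain
      _ ≤ 2 * (K * δ) + (Real.exp (-(2 * L))
          + m * (K + 1) * (2 * Real.exp (-(2 * L)))) := by gcongr
      _ = _ := by rw [hδsplit]; ring

lemma integral_regret_le [NeZero K] {I : Instance X K m}
    {S : ArgmaxRule m} {ε α : ℝ} (hε : ε ∈ Set.Ioc (0 : ℝ) 1) (hα : α ∈ Set.Ioc (0 : ℝ) 1)
    {ν : ProbabilityMeasure W} {σ : BidStrategy W X K} {T : ℕ} (hT : 1 ≤ T)
    (hrat : AlphaRational I S ε ν σ T α) (hK : 2 ≤ K) :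
    ∫ ω, regret I S ε σ T ω ∂(runLaw I ν) ≤
      T * ε + (K : ℝ) ^ 2 * Real.sqrt (8 * T * Real.log (T * m * K) / ε) + 3 * K
        + 8 * (K : ℝ) ^ 2 * Real.log (T * m * K) / (ε * α ^ 2) := by
  have hm : 1 ≤ m := Nat.one_le_iff_ne_zero.2 fun h => by
    subst h
    exact (S.pick 0).elim0
  have hT' : (1 : ℝ) ≤ T := by exact_mod_cast hT
  have hm' : (1 : ℝ) ≤ m := by exact_mod_cast hm
  have hK' : (2 : ℝ) ≤ K := by exact_mod_cast hK
  have hTm : (1 : ℝ) ≤ T * m := one_le_mul_of_one_le_of_one_le hT' hm'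
  have hN : (2 : ℝ) ≤ T * m * K := by nlinarith
  set N : ℝ := T * m * K with hNdef
  set L := Real.log N with hLdef
  have hL : 0 < L := Real.log_pos (by linarith)
  obtain ⟨hε0, hε1⟩ := hε
  have hx : 0 ≤ 8 * (K : ℝ) ^ 2 * L / (ε * α ^ 2) := by positivity
  have hsum := Finset.sum_le_sum (s := Finset.range T) fun t ht =>
    integral_bestWelfare_sub_followedAt_le_of_two_le ⟨hε0, hε1⟩ hα hrat (Finset.mem_range.1 ht)
      hK hL
  simp only [Finset.sum_add_distrib, ← Finset.mul_sum, Finset.sum_const, Finset.card_range,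
    nsmul_eq_mul] at hsum
  have hthreshold := sum_range_ite_lt_le T hx
  have hsqrt : 2 * K * Real.sqrt (2 * L / ε) * ∑ t ∈ Finset.range T, 1 / Real.sqrt t
      ≤ (K : ℝ) ^ 2 * Real.sqrt (8 * T * L / ε) := by
    have h8 : Real.sqrt (8 * T * L / ε) = 2 * (Real.sqrt (2 * L / ε) * Real.sqrt T) := by
      rw [← Real.sqrt_mul (by positivity),
        show 8 * T * L / ε = 2 ^ 2 * (2 * L / ε * T) by ring,
        Real.sqrt_mul (by norm_num), Real.sqrt_sq (by norm_num)]
    calc _ ≤ 2 * K * Real.sqrt (2 * L / ε) * (2 * Real.sqrt T) := by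
          gcongr
          exact sum_range_one_div_sqrt_le T
      _ = (2 * K) * Real.sqrt (8 * T * L / ε) := by rw [h8]; ring
      _ ≤ _ := by
          gcongr
          nlinarith
  have hfail : (T : ℝ) * ((1 + 2 * (m * (K + 1))) * Real.exp (-(2 * L))) ≤ 5 := by
    have hexp : Real.exp (-(2 * L)) = 1 / (N * N) := by
      rw [show -(2 * L) = -(L + L) by ring, Real.exp_neg, Real.exp_add, hLdef,
        Real.exp_log (by linarith), one_div]
    have hcount : 1 + 2 * ((m : ℝ) * (K + 1)) ≤ 5 * (m * K) := by nlinarith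
    rw [hexp, ← mul_assoc, mul_one_div, div_le_iff₀ (by positivity)]
    calc (T : ℝ) * (1 + 2 * (m * (K + 1))) ≤ T * (5 * (m * K)) := by gcongr
      _ = 5 * (N * 1) := by rw [hNdef]; ring
      _ ≤ 5 * (N * N) := by gcongr; linarith
  -- Rounding the threshold costs `1` and the failures at most `5`; together `6 ≤ 3 * K`.
  have hreg := integral_regret_le_sum I S ⟨hε0.le, hε1⟩ ν σ T
  linarith

/-- The exploration rate `2 T^(-1/3) L^(1/3) K^(4/3)` balances the terms of the regret bound. -/
lemma tuned_bound {T K L ε α r : ℝ} (hT : 1 ≤ T) (hK : 1 ≤ K) (hL : 0 < L) (hα : 0 < α)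
    (hε : ε = min 1 (2 * T ^ (-(1 / 3) : ℝ) * L ^ (1 / 3 : ℝ) * K ^ (4 / 3 : ℝ)))
    (hrT : r ≤ T)
    (hr : r ≤ T * ε + K ^ 2 * Real.sqrt (8 * T * L / ε) + 3 * K
      + 8 * K ^ 2 * L / (ε * α ^ 2)) :
    r ≤ 7 * (1 + L) ^ 1 * (T ^ (2 / 3 : ℝ) * K ^ (4 / 3 : ℝ)
      + T ^ (1 / 3 : ℝ) * K ^ (2 / 3 : ℝ) / α ^ 2) := by
  -- Everything is expressed through the cube roots `A`, `κ` and `l` of `T`, `K` and `L`.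
  have hcube {x : ℝ} (hx : 0 ≤ x) (n : ℕ) : x ^ ((n : ℝ) / 3) = (x ^ (1 / 3 : ℝ)) ^ n := by
    rw [← Real.rpow_natCast, ← Real.rpow_mul hx]
    congr 1
    ring
  have hT0 : 0 ≤ T := by linarith
  have hK0 : 0 ≤ K := by linarith
  have eT2 : T ^ (2 / 3 : ℝ) = (T ^ (1 / 3 : ℝ)) ^ 2 := by exact_mod_cast hcube hT0 2
  have eK2 : K ^ (2 / 3 : ℝ) = (K ^ (1 / 3 : ℝ)) ^ 2 := by exact_mod_cast hcube hK0 2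
  have eK4 : K ^ (4 / 3 : ℝ) = (K ^ (1 / 3 : ℝ)) ^ 4 := by exact_mod_cast hcube hK0 4
  have eT3 : T = (T ^ (1 / 3 : ℝ)) ^ 3 := by
    have := hcube hT0 3
    rwa [Nat.cast_ofNat, div_self (by norm_num), Real.rpow_one] at this
  have eK3 : K = (K ^ (1 / 3 : ℝ)) ^ 3 := by
    have := hcube hK0 3
    rwa [Nat.cast_ofNat, div_self (by norm_num), Real.rpow_one] at this
  have eL3 : L = (L ^ (1 / 3 : ℝ)) ^ 3 := by
    have := hcube hL.le 3
    rwa [Nat.cast_ofNat, div_self (by norm_num), Real.rpow_one] at this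
  rw [Real.rpow_neg hT0, eK4] at hε
  rw [eT2, eK2, eK4]
  have hA : 1 ≤ T ^ (1 / 3 : ℝ) := Real.one_le_rpow hT (by norm_num)
  have hκ : 1 ≤ K ^ (1 / 3 : ℝ) := Real.one_le_rpow hK (by norm_num)
  have hl : 0 < L ^ (1 / 3 : ℝ) := Real.rpow_pos_of_pos hL _
  generalize T ^ (1 / 3 : ℝ) = A at *
  generalize K ^ (1 / 3 : ℝ) = κ at *
  generalize L ^ (1 / 3 : ℝ) = l at *
  subst eT3 eK3 eL3
  have hA0 : 0 < A := by linarith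
  have hκ0 : 0 < κ := by linarith
  have hl1 : l ≤ 1 + l ^ 3 := by
    rcases le_total l 1 with h | h
    · nlinarith [pow_pos hl 3]
    · nlinarith [pow_le_pow_right₀ h (show 1 ≤ 3 by norm_num)]
  have hl2 : l ^ 2 ≤ 1 + l ^ 3 := by
    rcases le_total l 1 with h | h
    · nlinarith [pow_pos hl 3]
    · nlinarith [pow_le_pow_right₀ h (show 2 ≤ 3 by norm_num)]
  set P := A ^ 2 * κ ^ 4 with hP
  set Q := A * κ ^ 2 / α ^ 2 with hQ
  have hP0 : 0 < P := by positivity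
  have hQ0 : 0 < Q := by positivity
  have hPl := mul_le_mul_of_nonneg_right hl1 hP0.le
  have hQl := mul_le_mul_of_nonneg_right hl2 hQ0.le
  have hl3 : 0 < l ^ 3 := pow_pos hl 3
  have hPl3 := mul_pos hl3 hP0
  have hQl3 := mul_pos hl3 hQ0
  rw [pow_one]
  rcases le_total 1 (2 * A⁻¹ * l * κ ^ 4) with h1 | h1
  · -- Without exploitation the trivial bound `T` suffices.
    have hAle : A ≤ 2 * l * κ ^ 4 := by
      have := mul_le_mul_of_nonneg_left h1 hA0.le
      calc A = A * 1 := (mul_one A).symm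
        _ ≤ _ := this
        _ = _ := by field_simp
    have : A ^ 3 ≤ 2 * (l * P) := by
      calc A ^ 3 = A ^ 2 * A := by ring
        _ ≤ A ^ 2 * (2 * l * κ ^ 4) := by gcongr
        _ = _ := by rw [hP]; ring
    nlinarith
  · rw [min_eq_right h1] at hε
    have e1 : A ^ 3 * ε = 2 * (l * P) := by rw [hε, hP]; field_simp
    have e2 : (κ ^ 3) ^ 2 * Real.sqrt (8 * A ^ 3 * l ^ 3 / ε) = 2 * (l * P) := by
      have : 8 * A ^ 3 * l ^ 3 / ε = (2 * A ^ 2 * l / κ ^ 2) ^ 2 := by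
        rw [hε]; field_simp; norm_num
      rw [this, Real.sqrt_sq (by positivity), hP]
      field_simp
    have e3 : 8 * (κ ^ 3) ^ 2 * l ^ 3 / (ε * α ^ 2) = 4 * (l ^ 2 * Q) := by
      rw [hε, hQ]; field_simp; norm_num
    have e4 : κ ^ 3 ≤ P := by
      calc κ ^ 3 = 1 * κ ^ 3 := (one_mul _).symm
        _ ≤ A ^ 2 * κ ^ 4 := by
          gcongr
          · exact one_le_pow₀ hA
          · norm_num
    rw [e1, e2, e3] at hr
    nlinarith

end Total

end PPC

theorem mainTheorem1 :
    ∃ (C : ℝ) (k : ℕ),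
      ∀ (X : Type u) [MeasurableSpace X] (W : Type v) [MeasurableSpace W]
        (K m T : ℕ) [NeZero K] (I : PPC.Instance X K m) (S : PPC.ArgmaxRule m)
        (ν : ProbabilityMeasure W) (σ : PPC.BidStrategy W X K) (ε α : ℝ),
        1 ≤ T → 0 ≤ ε → ε ≤ 1 → 0 < α → α ≤ 1 →
        PPC.AlphaRational I S ε ν σ T α →
        Integrable (PPC.regret I S ε σ T) (PPC.runLaw I ν) ∧
        (0 < ε →
          ∫ ω, PPC.regret I S ε σ T ω ∂(PPC.runLaw I ν) ≤
            T * ε + (K : ℝ) ^ 2 * Real.sqrt (8 * T * Real.log (T * m * K) / ε) + 3 * K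
              + 8 * (K : ℝ) ^ 2 * Real.log (T * m * K) / (ε * α ^ 2)) ∧
        (ε = min 1 (2 * (T : ℝ) ^ (-(1 / 3) : ℝ) * Real.log (T * m * K) ^ (1 / 3 : ℝ)
              * (K : ℝ) ^ (4 / 3 : ℝ)) →
          ∫ ω, PPC.regret I S ε σ T ω ∂(PPC.runLaw I ν) ≤
            C * (1 + Real.log (T * m * K)) ^ k
              * ((T : ℝ) ^ (2 / 3 : ℝ) * (K : ℝ) ^ (4 / 3 : ℝ)
                + (T : ℝ) ^ (1 / 3 : ℝ) * (K : ℝ) ^ (2 / 3 : ℝ) / α ^ 2)) := by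
  refine ⟨7, 1, ?_⟩
  intro X _ W _ K m T _ I S ν σ ε α hT hε0 hε1 hα0 hα1 hrat
  refine ⟨PPC.integrable_regret I S ε ν σ T, ?_⟩
  have hLnonneg : 0 ≤ Real.log (T * m * K) := by
    have := Real.log_natCast_nonneg (T * m * K)
    rwa [Nat.cast_mul, Nat.cast_mul] at this
  rcases Nat.lt_or_ge K 2 with hK | hK
  · have hK1 : K = 1 := le_antisymm (Nat.lt_succ_iff.1 hK) (Nat.pos_of_ne_zero (NeZero.ne K))
    have : Subsingleton (Fin K) := by rw [hK1]; infer_instance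
    rw [PPC.integral_regret_eq_zero_of_subsingleton]
    exact ⟨fun _ => by positivity, fun _ => by positivity⟩
  · have hm : 1 ≤ m := Nat.one_le_iff_ne_zero.2 fun h => by
      subst h
      exact (S.pick 0).elim0
    have hT' : (1 : ℝ) ≤ T := by exact_mod_cast hT
    have hK' : (2 : ℝ) ≤ K := by exact_mod_cast hK
    have hbound := fun h : 0 < ε => PPC.integral_regret_le ⟨h, hε1⟩ ⟨hα0, hα1⟩ hT hrat hK
    refine ⟨hbound, fun hε => ?_⟩
    have hL : 0 < Real.log (T * m * K) := by
      refine Real.log_pos ?_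
      have : 1 < T * m * K := lt_of_lt_of_le hK (Nat.le_mul_of_pos_left K (Nat.mul_pos hT hm))
      exact_mod_cast this
    have hpos : 0 < ε := by
      rw [hε]
      exact lt_min one_pos (by positivity)
    exact PPC.tuned_bound hT' (by linarith) hL hα0 hε
      (PPC.integral_regret_le_card I S ε ν σ T) (hbound hpos)
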